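/- Let $k$ be a unital commutative ring and $[n]=\{0,\dots,n\}$ for $n\ge 0$. For a small category $\mathbf C$ and functors $G\colon\mathbf C^{op}\to\mathbf{Mod}_k$, $F\colon\mathbf C\to\mathbf{Mod}_k$, let $\mathrm{Tor}^{\mathbf C}_\star(G,F)$ denote the left derived functors of the tensor product $G\otimes_{\mathbf C}F=\int^{C}G(C)\otimes_k F(C)$, and let $k^\ast$ be the constant functor with value $k$. Let $C_2=\{1,t\}$. The category $\mathcal{IF}(as)$ of involutive non-commutative sets has objects $[n]$; a morphism $f\colon[n]\to[m]$ is a map of sets with a total ordering on each $f^{-1}(i)$ and a label in $C_2$ for each element of $[n]$; composition is given by composing maps, with $(g\circ f)^{-1}(i)$ the ordered disjoint union $\coprod_{j^\alpha\in g^{-1}(i)}\alpha\ast f^{-1}(j)$, where $t$ acts by inverting the ordering and multiplying all labels by $t$. The subcategory $\mathcal{I}\Gamma(as)$ has the same objects and the morphisms with $f(0)=0$. Let $\mathbf H^+\subset\mathcal{I}\Gamma(as)$ be the groupoid of those automorphisms $f$ of the $[n]$ with $f(0)=0$ for which the label of $0$ is $1$, and let $\Delta D\subset\mathcal{IF}(as)$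 be the subcategory generated by $\Delta$ (monotone maps, natural orderings, trivial labels) and, for each $n$, the automorphisms $i\mapsto n-i$ with all labels $t$ and $i\mapsto i+1 \pmod{n+1}$ with all labels $1$. Every morphism $f$ of $\mathcal{IF}(as)$ can be written uniquely as a morphism $f_{\mathbf H^+}$ of $\mathbf H^+$ followed by a morphism of $\Delta D$. Let $B\colon\mathcal{IF}(as)^{op}\to\mathbf{Mod}_k$ be the functor \[B([n])=k\Big[\coprod_{m\ge0}\mathrm{Hom}_{\mathbf H^+}([n],[m])\Big],\] where $f\colon[n]\to[n']$ acts by precomposition, $h\mapsto (h\circ f)_{\mathbf H^+}$, and let $B'$ be its restriction to $\mathcal{I}\Gamma(as)$. Let $\Delta R$ be the reflexive category: its objects are the $[n]$, and its morphisms $[m]\to[n]$ are the formal composites $\varphi\circ r^{\varepsilon}$ with $\varphi\colon[m]\to[n]$ monotone and $\varepsilon\in\mathbb Z/2$, with $r^2=1$ and $r\circ\varphi\circ r$ equal to $i\mapsto n-\varphi(m-i)$. Let $i\colon\Delta R^{op}\to\mathcal{I}\Gamma(as)$ be the following inclusion, the identity on objects. A monotone map $\varphi\colon[m]\to[n]$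 is sent to the map $[n]\to[m]$ taking $j$ to $\min\{y:\varphi(y)\ge j\}$, or to $0$ if there is no such $y$, with all labels $1$ and the natural orderings on fibres, except that over $0$ the elements $j$ with no such $y$ come first; the reflection $r$ of $[n]$ is sent to $0\mapsto 0$, $j\mapsto n+1-j$ $(j>0)$ with all labels $t$. Reflexive homology of $F\colon\Delta R^{op}\to\mathbf{Mod}_k$ is $HR_\star(F)=\mathrm{Tor}^{\Delta R^{op}}_\star(k^\ast,F)$. \textbf{Theorem.} For every functor $F\colon\mathcal{I}\Gamma(as)\to\mathbf{Mod}_k$ there is an isomorphism of graded $k$-modules \[HR_\star(F\circ i)=\mathrm{Tor}^{\Delta R^{op}}_\star(k^\ast,F\circ i)\cong\mathrm{Tor}^{\mathcal{I}\Gamma(as)}_\star(B',F).\] -/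

import Mathlib

open CategoryTheory Limits Opposite MonoidalCategory

universe u

noncomputable section

/-! ### Functor homology -/

namespace FunctorHomology

variable (k : Type u) [CommRing k]

section
variable {C : Type} [SmallCategory C]

/-- The bifunctor `(c, c') ↦ G(c) ⊗ F(c')`, functorially in `F`. -/
def tensorBifunctor (G : Cᵒᵖ ⥤ ModuleCat.{u} k) :
    (C ⥤ ModuleCat.{u} k) ⥤ (Cᵒᵖ ⥤ C ⥤ ModuleCat.{u} k) where
  obj F := G ⋙ curriedTensor (ModuleCat.{u} k) ⋙ (Functor.whiskeringLeft _ _ _).obj F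
  map η := { app := fun X => Functor.whiskerRight η ((curriedTensor (ModuleCat.{u} k)).obj (G.obj X)) 
             naturality := by
              intro X Y f
              ext c : 2
              simp [← MonoidalCategory.whisker_exchange] }

/-- The functor `F ↦ G ⊗_C F`, where `G ⊗_C F` is the coend of `(c, c') ↦ G(c) ⊗ F(c')`. -/
def tensorFunctor (G : Cᵒᵖ ⥤ ModuleCat.{u} k) : (C ⥤ ModuleCat.{u} k) ⥤ ModuleCat.{u} k :=
  tensorBifunctor k G ⋙ coendFunctor C (ModuleCat.{u} k)

/-- The canonical map of `G(c) ⊗ F(c)` to the coend `G ⊗_C F`. -/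
def tensorι (G : Cᵒᵖ ⥤ ModuleCat.{u} k) (F : C ⥤ ModuleCat.{u} k) (c : C) :
    G.obj (op c) ⊗ F.obj c ⟶ (tensorFunctor k G).obj F :=
  coend.ι ((tensorBifunctor k G).obj F) c

instance (G : Cᵒᵖ ⥤ ModuleCat.{u} k) : (tensorFunctor k G).Additive where
  map_add {X Y f g} := by
    have hι : ∀ (h : X ⟶ Y) (j : C),
        tensorι k G X j ≫ (tensorFunctor k G).map h =
          ((G.obj (op j)) ◁ h.app j) ≫ tensorι k G Y j :=
      fun h j => coend.ι_map _ _
    apply coend.hom_ext (F := (tensorBifunctor k G).obj X)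
    intro j
    change tensorι k G X j ≫ (tensorFunctor k G).map (f + g) =
      tensorι k G X j ≫ ((tensorFunctor k G).map f + (tensorFunctor k G).map g)
    rw [Preadditive.comp_add, hι, hι, hι, NatTrans.app_add, MonoidalPreadditive.whiskerLeft_add,
      Preadditive.add_comp]

/-- Modules over a small category have enough projectives, so that derived functors exist. -/
instance : EnoughProjectives (C ⥤ ModuleCat.{u} k) where
  presentation F := by
    let P : C → (C ⥤ ModuleCat.{u} k) := fun c =>
      (evaluationLeftAdjoint (ModuleCat.{u} k) c).obj (Projective.over (F.obj c))
    have hP : ∀ c, Projective (P c) := fun c =>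
      (evaluationAdjunctionRight (ModuleCat.{u} k) c).map_projective _ inferInstance
    let π : ∀ c, P c ⟶ F := fun c =>
      ((evaluationAdjunctionRight (ModuleCat.{u} k) c).homEquiv _ _).symm (Projective.π (F.obj c))
    have hproj : Projective (∐ P) := ⟨fun f e he => by
      refine ⟨Sigma.desc fun c => Projective.factorThru (Sigma.ι P c ≫ f) e, ?_⟩
      apply Sigma.hom_ext
      intro c
      simp⟩
    have hπ : Epi (Sigma.desc π) := by
      rw [NatTrans.epi_iff_epi_app]
      intro c
      have h : ((evaluationAdjunctionRight (ModuleCat.{u} k) c).homEquiv _ _) (π c)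
          = Projective.π (F.obj c) := Equiv.apply_symm_apply _ _
      rw [Adjunction.homEquiv_unit, ← Sigma.ι_desc π c, Functor.map_comp, ← Category.assoc] at h
      exact epi_of_epi_fac h
    exact ⟨{ p := ∐ P, projective := hproj, f := Sigma.desc π, epi := hπ }⟩

/-- `Tor^C_*(G, F)`, a graded `k`-module: the left derived functors of the tensor product
`G ⊗_C -`, evaluated at `F`. -/
def Tor (G : Cᵒᵖ ⥤ ModuleCat.{u} k) (F : C ⥤ ModuleCat.{u} k) : GradedObject ℕ (ModuleCat.{u} k) :=
  fun n => ((tensorFunctor k G).leftDerived n).obj F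

/-- The `k`-constant right module `k^*`: value `k` on objects, identities on morphisms. -/
def constantFunctor : Cᵒᵖ ⥤ ModuleCat.{u} k :=
  (Functor.const Cᵒᵖ).obj (ModuleCat.of k k)

end
end FunctorHomology

/-! ### Involutive non-commutative sets -/

/-- The objects `[n] = {0, …, n}` of the category of involutive non-commutative sets. -/
structure IFas where
  len : ℕ

namespace IFas

lemma one_ne_t : (1 : ℤˣ) ≠ -1 := by decide

/-- A morphism `[n] ⟶ [m]` of involutive non-commutative sets: a map of sets, together with a
total ordering on each fibre and a label in `C₂` for each element.  The orderings are recorded as one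
relation, `lt a b` meaning that `a` and `b` lie in the same fibre and `a` precedes `b` there. The group
`C₂` is `ℤˣ`, with generator `t = -1`. -/
@[ext]
structure Hom (X Y : IFas) where
  toFun : Fin (X.len + 1) → Fin (Y.len + 1)
  lt : Fin (X.len + 1) → Fin (X.len + 1) → Prop
  label : Fin (X.len + 1) → ℤˣ
  lt_fiber : ∀ a b, lt a b → toFun a = toFun b
  lt_irrefl : ∀ a, ¬ lt a a
  lt_trans : ∀ a b c, lt a b → lt b c → lt a c
  lt_total : ∀ a b, toFun a = toFun b → a ≠ b → lt a b ∨ lt b a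

/-- The ordering on the fibres after acting by `α ∈ C₂`: reversed if `α = t`. -/
def Hom.twistedLt {X Y : IFas} (f : Hom X Y) (α : ℤˣ) (a b : Fin (X.len + 1)) : Prop :=
  (α = 1 ∧ f.lt a b) ∨ (α = -1 ∧ f.lt b a)

def Hom.id (X : IFas) : Hom X X where
  toFun a := a
  lt _ _ := False
  label _ := 1
  lt_fiber := by simp
  lt_irrefl := by simp
  lt_trans := by simp
  lt_total _ _ h h' := (h' h).elim

/-- Composition. The fibre of the composite over `i` is the ordered disjoint union, over `j` in the
fibre of `g` over `i`, of `α_j * f⁻¹(j)` where `α_j` is the label of `j`; the action of `t` inverts the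
ordering and multiplies all labels by `t`. -/
def Hom.comp {X Y Z : IFas} (f : Hom X Y) (g : Hom Y Z) : Hom X Z where
  toFun a := g.toFun (f.toFun a)
  lt a b := g.lt (f.toFun a) (f.toFun b) ∨
    (f.toFun a = f.toFun b ∧ f.twistedLt (g.label (f.toFun a)) a b)
  label a := g.label (f.toFun a) * f.label a
  lt_fiber a b := by
    rintro (h | ⟨h, -⟩)
    · exact g.lt_fiber _ _ h
    · rw [h]
  lt_irrefl a := by
    have := g.lt_irrefl (f.toFun a)
    have := f.lt_irrefl a
    simp only [Hom.twistedLt]; tauto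
  lt_trans a b c := by
    have h1 := g.lt_trans (f.toFun a) (f.toFun b) (f.toFun c)
    have h2 := f.lt_trans a b c
    have h3 := f.lt_trans c b a
    have h4 := one_ne_t
    simp only [Hom.twistedLt]
    grind
  lt_total a b h h' := by
    have h1 := g.lt_total (f.toFun a) (f.toFun b) h
    have h2 := f.lt_total a b
    have h3 := Int.units_eq_one_or (g.label (f.toFun a))
    simp only [Hom.twistedLt]
    grind

/-- The category of involutive non-commutative sets. -/
instance : SmallCategory IFas where
  Hom := Hom
  id := Hom.id
  comp := Hom.comp
  id_comp f := by
    apply Hom.ext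
    · rfl
    · funext a b
      simp [Hom.comp, Hom.id, Hom.twistedLt]
    · funext a
      simp [Hom.comp, Hom.id]
  comp_id f := by
    apply Hom.ext
    · rfl
    · funext a b
      have := f.lt_fiber a b
      have h4 := one_ne_t
      simp only [Hom.comp, Hom.id, Hom.twistedLt, eq_iff_iff]
      grind
    · funext a
      simp [Hom.comp, Hom.id]
  assoc f g h := by
    apply Hom.ext
    · rfl
    · funext a b
      have h1 := Int.units_eq_one_or (h.label (g.toFun (f.toFun a)))
      have h2 := Int.units_eq_one_or (g.label (f.toFun a))
      have h3 := g.lt_fiber (f.toFun a) (f.toFun b)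
      have h4 := g.lt_irrefl (f.toFun a)
      simp only [Hom.comp, Hom.twistedLt, eq_iff_iff]
      rcases h1 with h1 | h1 <;> rcases h2 with h2 | h2 <;> simp [h1, h2, one_ne_t.symm] <;>
        grind [one_ne_t]
    · funext a
      simp [Hom.comp, mul_assoc]

section lemmas
variable {X Y Z : IFas}

@[ext] lemma hom_ext {f g : X ⟶ Y} (h1 : f.toFun = g.toFun) (h2 : f.lt = g.lt)
    (h3 : f.label = g.label) : f = g := Hom.ext h1 h2 h3
@[simp] lemma id_toFun (a) : Hom.toFun (𝟙 X) a = a := rfl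
@[simp] lemma id_label (a) : Hom.label (𝟙 X) a = 1 := rfl
@[simp] lemma id_lt (a b) : Hom.lt (𝟙 X) a b ↔ False := Iff.rfl
@[simp] lemma comp_toFun (f : X ⟶ Y) (g : Y ⟶ Z) (a) :
  Hom.toFun (f ≫ g) a = g.toFun (f.toFun a) := rfl
@[simp] lemma comp_label (f : X ⟶ Y) (g : Y ⟶ Z) (a) :
  Hom.label (f ≫ g) a = g.label (f.toFun a) * f.label a := rfl
@[simp] lemma comp_lt (f : X ⟶ Y) (g : Y ⟶ Z) (a b) :
  Hom.lt (f ≫ g) a b ↔ g.lt (f.toFun a) (f.toFun b) ∨ (f.toFun a = f.toFun b ∧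
    ((g.label (f.toFun a) = 1 ∧ f.lt a b) ∨ (g.label (f.toFun a) = -1 ∧ f.lt b a))) := Iff.rfl
end lemmas

/-- The element `(z; σ)` of the hyperoctahedral group, as an automorphism of `[n]`. -/
def ofPerm (X : IFas) (σ : Equiv.Perm (Fin (X.len + 1))) (z : Fin (X.len + 1) → ℤˣ) : X ⟶ X where
  toFun := σ
  lt _ _ := False
  label := z
  lt_fiber := by simp
  lt_irrefl := by simp
  lt_trans := by simp
  lt_total _ _ h h' := (h' (σ.injective h)).elim

/-- Based morphisms: `f(0) = 0`. -/
def isBased : MorphismProperty IFas := fun _ _ f => f.toFun 0 = 0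

instance : isBased.IsMultiplicative where
  id_mem _ := rfl
  comp_mem f g hf hg := by
    simp only [isBased, comp_toFun] at *
    rw [hf, hg]

/-- The morphisms of the groupoid `H⁺`: the automorphisms `(z; σ)` with `σ(0) = 0` and `z_0 = 1`.
(A bijection `[n] ⟶ [m]` forces `n = m`, and the fibres carry no further data.) -/
def isHPlus : MorphismProperty IFas := fun _ _ f =>
  Function.Bijective f.toFun ∧ f.toFun 0 = 0 ∧ f.label 0 = 1

/-- Generators of the dihedral category `ΔD` inside involutive non-commutative sets: the morphisms
of `Δ` (monotone maps, with the natural ordering on fibres and trivial labels), and in each degree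
the generators `R = (t, …, t; r)`, `r(i) = n - i`, and `T = (1, …, 1; i ↦ i + 1)` of the dihedral group. -/
inductive dihedralGenerators : MorphismProperty IFas
  | ofDelta {X Y : IFas} (f : X ⟶ Y) (hmono : Monotone f.toFun)
      (hlt : ∀ a b, f.lt a b ↔ f.toFun a = f.toFun b ∧ a < b) (hlabel : ∀ a, f.label a = 1) :
      dihedralGenerators f
  | reflection (X : IFas) : dihedralGenerators (ofPerm X Fin.revPerm fun _ => -1)
  | rotation (X : IFas) : dihedralGenerators (ofPerm X (finRotate (X.len + 1)) fun _ => 1)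

/-- The dihedral category `ΔD`, as a subcategory of involutive non-commutative sets with the same
objects: the subcategory generated by `Δ` and the dihedral groups. -/
def isDeltaD : MorphismProperty IFas := dihedralGenerators.multiplicativeClosure

instance : isDeltaD.IsMultiplicative := by unfold isDeltaD; infer_instance

lemma ofPerm_comp (X : IFas) (σ τ : Equiv.Perm (Fin (X.len + 1))) (z w : Fin (X.len + 1) → ℤˣ) :
    ofPerm X σ z ≫ ofPerm X τ w = ofPerm X (σ.trans τ) (fun a => w (σ a) * z a) := by
  apply hom_ext
  · rfl
  · funext a b; simp [ofPerm]
  · rfl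

lemma isDeltaD_rotate (X : IFas) (k : Fin (X.len + 1)) :
    isDeltaD (ofPerm X (Equiv.addRight k) fun _ => 1) := by
  induction k using Fin.induction with
  | zero =>
    have : ofPerm X (Equiv.addRight 0) (fun _ => 1) = 𝟙 X := by
      apply hom_ext
      · funext a; simp [ofPerm]
      · rfl
      · rfl
    rw [this]
    exact isDeltaD.id_mem X
  | succ k ih =>
    have : ofPerm X (Equiv.addRight k.succ) (fun _ => 1) =
        ofPerm X (Equiv.addRight k.castSucc) (fun _ => 1) ≫
          ofPerm X (finRotate (X.len + 1)) (fun _ => 1) := by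
      rw [ofPerm_comp]
      congr 1
      ext a
      simp [add_assoc]
    rw [this]
    exact isDeltaD.comp_mem _ _ ih (.of _ (.rotation X))

lemma isDeltaD_reflect (X : IFas) (k : Fin (X.len + 1)) :
    isDeltaD (ofPerm X (Equiv.subLeft k) fun _ => -1) := by
  have : ofPerm X (Equiv.subLeft k) (fun _ => -1) =
      ofPerm X Fin.revPerm (fun _ => -1) ≫
        ofPerm X (Equiv.addRight (k + 1)) (fun _ => 1) := by
    rw [ofPerm_comp]
    congr 1
    · ext1 a
      have : Fin.rev a = - a - 1 := by
        rw [← Fin.last_sub, eq_sub_iff_add_eq]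
        have : Fin.last X.len + 1 = 0 := by simp
        rw [sub_add_eq_add_sub, this, zero_sub]
      simp [this]
      abel
  rw [this]
  exact isDeltaD.comp_mem _ _ (.of _ (.reflection X)) (isDeltaD_rotate X _)

/-- The total ordering of the source obtained by concatenating the fibres. -/
def tlt {X Y : IFas} (f : X ⟶ Y) (a b : Fin (X.len + 1)) : Prop :=
  f.toFun a < f.toFun b ∨ f.lt a b

lemma tlt_irrefl {X Y : IFas} (f : X ⟶ Y) (a) : ¬ tlt f a a := by
  have := f.lt_irrefl a
  grind [tlt]

lemma tlt_trans {X Y : IFas} (f : X ⟶ Y) {a b c} (h : tlt f a b) (h' : tlt f b c) :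
    tlt f a c := by
  have := f.lt_trans a b c
  have := f.lt_fiber a b
  have := f.lt_fiber b c
  grind [tlt]

lemma tlt_total {X Y : IFas} (f : X ⟶ Y) {a b} (h : a ≠ b) : tlt f a b ∨ tlt f b a := by
  have := f.lt_total a b
  grind [tlt]

/-- The cyclic order induced by the relation `r`. -/
def Cyc {α : Type} (r : α → α → Prop) (a b c : α) : Prop :=
  (r a b ∧ r b c) ∨ (r b c ∧ r c a) ∨ (r c a ∧ r a b)

/-- An invariant of the morphisms of `ΔD`: constant labels, and the cyclic order is preserved or
reversed accordingly. -/
def Inv {X Y : IFas} (f : X ⟶ Y) : Prop :=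
  (∀ a, f.label a = f.label 0) ∧ ∀ a b c, Cyc (· < ·) a b c →
    (f.label 0 = 1 → Cyc (tlt f) a b c) ∧ (f.label 0 = -1 → Cyc (tlt f) c b a)

lemma Inv.comp {X Y Z : IFas} {f : X ⟶ Y} {g : Y ⟶ Z} (hf : Inv f) (hg : Inv g) :
    Inv (f ≫ g) := by
  obtain ⟨hf1, hf2⟩ := hf
  obtain ⟨hg1, hg2⟩ := hg
  refine ⟨fun a => by simp [hf1 a, hg1 (f.toFun a), hg1 (f.toFun 0)], fun a b c habc => ?_⟩
  have key : ∀ a b, tlt (f ≫ g) a b ↔ tlt g (f.toFun a) (f.toFun b) ∨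
     (f.toFun a = f.toFun b ∧
    ((g.label 0 = 1 ∧ f.lt a b) ∨ (g.label 0 = -1 ∧ f.lt b a))) := by
    intro a b
    simp [tlt, hg1 (f.toFun a), or_assoc]
  have hstep : ∀ a b c, Cyc (tlt f) a b c →
      (g.label 0 = 1 → Cyc (tlt (f ≫ g)) a b c) ∧ (g.label 0 = -1 → Cyc (tlt (f ≫ g)) c b a) := by
    intro a b c h
    have h1 := hg2 (f.toFun a) (f.toFun b) (f.toFun c)
    have h1ab := f.lt_fiber a b
    have h1bc := f.lt_fiber b c
    have h1ca := f.lt_fiber c a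
    have h2ab := @tlt_total _ _ g (f.toFun a) (f.toFun b)
    have h2bc := @tlt_total _ _ g (f.toFun b) (f.toFun c)
    have h2ca := @tlt_total _ _ g (f.toFun c) (f.toFun a)
    have h3 : (1 : ℤˣ) ≠ -1 := by decide
    simp only [Cyc, key] at h h1 ⊢
    simp only [tlt] at h
    constructor
    · intro h0
      simp only [h0, h3, true_and, false_and, or_false, forall_const] at h1 ⊢
      grind
    · intro h0
      simp only [h0, h3.symm, true_and, false_and, false_or, forall_const] at h1 ⊢
      grind
  have h1 := Int.units_eq_one_or (g.label 0)
  have h2 := Int.units_eq_one_or (f.label 0)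
  have h3 := hf2 a b c habc
  have h4 := hstep a b c
  have h5 := hstep c b a
  have h6 : (1 : ℤˣ) ≠ -1 := by decide
  simp only [comp_label, hg1 (f.toFun 0)]
  rcases h1 with h1 | h1 <;> rcases h2 with h2 | h2 <;>
    simp [h1, h2, h6, h6.symm] at h3 h4 h5 ⊢ <;> grind

lemma inv_of_isDeltaD {X Y : IFas} {f : X ⟶ Y} (hf : isDeltaD f) : Inv f := by
  have hgen : ∀ {X Y : IFas} (f : X ⟶ Y), dihedralGenerators f → Inv f := by
    intro X Y f hf
    have h6 : (1 : ℤˣ) ≠ -1 := by decide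
    cases hf with
    | ofDelta _ hmono hlt hlabel =>
      refine ⟨by simp [hlabel], fun a b c habc => ⟨fun _ => ?_, fun h => ?_⟩⟩
      · have : ∀ a b, a < b → tlt f a b := by
          intro a b h
          rcases (hmono h.le).lt_or_eq with h' | h'
          · exact .inl h'
          · exact .inr ((hlt a b).2 ⟨h', h⟩)
        unfold Cyc at *
        grind
      · exact (h6 ((hlabel 0).symm.trans h)).elim
    | reflection =>
      refine ⟨fun _ => rfl, fun a b c habc => ⟨fun h => (h6.symm h).elim, fun _ => ?_⟩⟩
      simp only [Cyc, tlt, ofPerm, Fin.revPerm_apply, Fin.rev_lt_rev, or_false] at habc ⊢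
      tauto
    | rotation =>
      refine ⟨fun _ => rfl, fun a b c habc => ⟨fun _ => ?_, fun h => (h6 h).elim⟩⟩
      simp only [Cyc, tlt, ofPerm, or_false, Fin.lt_def, coe_finRotate] at habc ⊢
      simp only [Fin.ext_iff, Fin.val_last] at habc ⊢
      grind
  induction hf with
  | of f hf => exact hgen f hf
  | id X =>
    refine hgen _ (.ofDelta _ (fun a b h => h) (fun a b => ?_) (fun a => rfl))
    simp only [id_lt, id_toFun, false_iff]
    grind
  | comp_of f g _ hg ih => exact ih.comp (hgen g hg)


lemma exists_sort {X Y : IFas} (f : X ⟶ Y) :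
    ∃ s : Equiv.Perm (Fin (X.len + 1)), ∀ a b, s a < s b ↔ tlt f a b := by
  classical
  have hlt : ∀ a, (Finset.univ.filter fun c => tlt f c a).card < X.len + 1 := by
    intro a
    have : (Finset.univ.filter fun c => tlt f c a) ⊂ Finset.univ :=
      Finset.filter_ssubset.2 ⟨a, Finset.mem_univ a, tlt_irrefl f a⟩
    simpa using Finset.card_lt_card this
  let r : Fin (X.len + 1) → Fin (X.len + 1) := fun a => ⟨_, hlt a⟩
  have hmono : ∀ a b, tlt f a b → r a < r b := by
    intro a b h
    change (Finset.univ.filter fun c => tlt f c a).card < (Finset.univ.filter fun c => tlt f c b).card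
    refine Finset.card_lt_card ((Finset.ssubset_iff_of_subset ?_).2 ⟨a, ?_, ?_⟩)
    · intro c hc
      simp only [Finset.mem_filter, Finset.mem_univ, true_and] at hc ⊢
      exact tlt_trans f hc h
    · simpa using h
    · simpa using tlt_irrefl f a
  have hiff : ∀ a b, r a < r b ↔ tlt f a b := by
    intro a b
    refine ⟨fun h => ?_, hmono a b⟩
    have hab : a ≠ b := by rintro rfl; exact lt_irrefl _ h
    exact (tlt_total f hab).resolve_right fun h' => lt_asymm h (hmono b a h')
  have hinj : Function.Injective r := by
    intro a b h
    by_contra hab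
    rcases tlt_total f hab with h' | h'
    · exact (hmono _ _ h').ne h
    · exact (hmono _ _ h').ne h.symm
  exact ⟨Equiv.ofBijective r (Finite.injective_iff_bijective.1 hinj), hiff⟩

lemma exists_factorization {X Y : IFas} (f : X ⟶ Y) :
    ∃ (h : X ⟶ X) (d : X ⟶ Y), isHPlus h ∧ isDeltaD d ∧ h ≫ d = f := by
  obtain ⟨s, hs⟩ := exists_sort f
  let φ : X ⟶ Y :=
    { toFun := fun a => f.toFun (s.symm a)
      lt := fun a b => f.toFun (s.symm a) = f.toFun (s.symm b) ∧ a < b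
      label := fun _ => 1
      lt_fiber := fun _ _ h => h.1
      lt_irrefl := fun _ h => lt_irrefl _ h.2
      lt_trans := fun _ _ _ h h' => ⟨h.1.trans h'.1, h.2.trans h'.2⟩
      lt_total := fun _ _ h h' => (lt_or_gt_of_ne h').imp (⟨h, ·⟩) (⟨h.symm, ·⟩) }
  have hφ : isDeltaD φ := by
    refine .of _ (.ofDelta _ ?_ (fun _ _ => Iff.rfl) fun _ => rfl)
    intro a b hab
    rcases hab.lt_or_eq with h | rfl
    · have := (hs (s.symm a) (s.symm b)).1 (by simpa using h)
      rcases this with h' | h'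
      · exact h'.le
      · exact (f.lt_fiber _ _ h').le
    · exact le_rfl
  have hf : ofPerm X s f.label ≫ φ = f := by
    apply hom_ext
    · funext a; simp [ofPerm, φ]
    · funext a b
      have h1 := f.lt_fiber a b
      have h2 := f.lt_irrefl a
      simp only [comp_lt, ofPerm, φ, Equiv.symm_apply_apply, hs, tlt, eq_iff_iff]
      grind
    · funext a; simp [ofPerm, φ]
  rcases Int.units_eq_one_or (f.label 0) with h0 | h0
  · refine ⟨ofPerm X (s.trans (Equiv.subRight (s 0))) f.label,
      ofPerm X (Equiv.addRight (s 0)) (fun _ => 1) ≫ φ,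
      ⟨Equiv.bijective _, ?_, h0⟩, isDeltaD.comp_mem _ _ (isDeltaD_rotate _ _) hφ, ?_⟩
    · simp [ofPerm]
    · rw [← Category.assoc, ofPerm_comp]
      convert hf using 3
      · ext1 a; simp
      · simp
  · refine ⟨ofPerm X (s.trans (Equiv.subLeft (s 0))) (fun a => - f.label a),
      ofPerm X (Equiv.subLeft (s 0)) (fun _ => -1) ≫ φ,
      ⟨Equiv.bijective _, ?_, ?_⟩, isDeltaD.comp_mem _ _ (isDeltaD_reflect _ _) hφ, ?_⟩
    · simp [ofPerm]
    · simp [ofPerm, h0]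
    · rw [← Category.assoc, ofPerm_comp]
      convert hf using 3
      · ext1 a; simp
      · simp

lemma isHPlus.lt_iff_false {X Y : IFas} {h : X ⟶ Y} (hh : isHPlus h) (a b) : ¬ h.lt a b := by
  intro hab
  obtain rfl := hh.1.1 (h.lt_fiber _ _ hab)
  exact h.lt_irrefl _ hab

lemma isHPlus.eq_dom {X Y : IFas} {h : X ⟶ Y} (hh : isHPlus h) : Y = X := by
  have := Fintype.card_of_bijective hh.1
  cases X; cases Y
  simp at this
  rw [this]

lemma factorization_unique {X Y : IFas} {h h' : X ⟶ X} {d d' : X ⟶ Y}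
    (hh : isHPlus h) (hh' : isHPlus h') (hd : isDeltaD d) (hd' : isDeltaD d')
    (heq : h ≫ d = h' ≫ d') : h = h' := by
  obtain ⟨f, hf⟩ : ∃ f, f = h ≫ d := ⟨_, rfl⟩
  have hf' := hf.trans heq
  have key : ∀ {h : X ⟶ X} {d : X ⟶ Y}, isHPlus h → isDeltaD d → f = h ≫ d →
      (∀ a, f.label a = f.label 0 * h.label a) ∧
      (∀ a b, a ≠ 0 → h.toFun a < h.toFun b →
        (f.label 0 = 1 → Cyc (tlt f) 0 a b) ∧ (f.label 0 = -1 → Cyc (tlt f) b a 0)) := by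
    rintro h d hh hd rfl
    obtain ⟨hd1, hd2⟩ := inv_of_isDeltaD hd
    have ht : ∀ a b, tlt (h ≫ d) a b ↔ tlt d (h.toFun a) (h.toFun b) := by
      intro a b
      simp [tlt, hh.lt_iff_false]
    refine ⟨fun a => ?_, fun a b ha hab => ?_⟩
    · simp only [comp_label, hh.2.1, hh.2.2, mul_one, hd1 (h.toFun a)]
    · simp only [Cyc, ht, comp_label, hh.2.1, hh.2.2, mul_one]
      refine hd2 0 (h.toFun a) (h.toFun b) (.inl ⟨?_, hab⟩)
      change 0 < h.toFun a
      rw [Fin.pos_iff_ne_zero]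
      exact fun h' => ha (hh.1.1 (h'.trans hh.2.1.symm))
  obtain ⟨k1, k2⟩ := key hh hd hf
  obtain ⟨k1', k2'⟩ := key hh' hd' hf'
  have hlt : ∀ a b, h.toFun a < h.toFun b → h'.toFun a < h'.toFun b := by
    intro a b hab
    have hne : a ≠ b := by rintro rfl; exact lt_irrefl _ hab
    have hb : b ≠ 0 := by
      rintro rfl
      rw [hh.2.1] at hab
      simp at hab
    by_cases ha : a = 0
    · subst ha
      rw [hh'.2.1, Fin.pos_iff_ne_zero]
      exact fun h' => hb (hh'.1.1 (h'.trans hh'.2.1.symm))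
    · rcases lt_trichotomy (h'.toFun a) (h'.toFun b) with h1 | h1 | h1
      · exact h1
      · exact (hne (hh'.1.1 h1)).elim
      · exfalso
        have e1 := k2 a b ha hab
        have e2 := k2' b a hb h1
        have i1 := tlt_irrefl f a
        have i2 := tlt_irrefl f b
        have i3 := tlt_irrefl f 0
        have t1 := @tlt_trans _ _ f
        rcases Int.units_eq_one_or (f.label 0) with h0 | h0
        · replace e1 := e1.1 h0
          replace e2 := e2.1 h0
          unfold Cyc at e1 e2
          rcases e1 with ⟨p, q⟩ | ⟨p, q⟩ | ⟨p, q⟩ <;> rcases e2 with ⟨p', q'⟩ | ⟨p', q'⟩ | ⟨p', q'⟩ <;>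
            have r1 := t1 p q <;> have r2 := t1 p' q' <;>
            first | exact i1 (t1 ‹_› ‹_›) | exact i2 (t1 ‹_› ‹_›) | exact i3 (t1 ‹_› ‹_›) | grind
        · replace e1 := e1.2 h0
          replace e2 := e2.2 h0
          unfold Cyc at e1 e2
          rcases e1 with ⟨p, q⟩ | ⟨p, q⟩ | ⟨p, q⟩ <;> rcases e2 with ⟨p', q'⟩ | ⟨p', q'⟩ | ⟨p', q'⟩ <;>
            have r1 := t1 p q <;> have r2 := t1 p' q' <;>
            first | exact i1 (t1 ‹_› ‹_›) | exact i2 (t1 ‹_› ‹_›) | exact i3 (t1 ‹_› ‹_›) | grind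
  have hfun : h.toFun = h'.toFun := by
    let e := Equiv.ofBijective _ hh.1
    have hm : StrictMono (h'.toFun ∘ e.symm) := by
      intro a b hab
      refine hlt _ _ ?_
      change e (e.symm a) < e (e.symm b)
      simpa using hab
    have : h'.toFun ∘ e.symm = id := (StrictMono.range_inj hm strictMono_id).1 (by
      rw [(hh'.1.surjective.comp e.symm.surjective).range_eq]; simp)
    funext a
    have h2 := congrFun this (e a)
    simp only [Function.comp_apply, Equiv.symm_apply_apply, id] at h2
    exact h2.symm
  apply hom_ext hfun
  · funext a b
    simp [hh.lt_iff_false, hh'.lt_iff_false]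
  · funext a
    exact mul_left_cancel ((k1 a).symm.trans (k1' a))

/-- The set `∐_m Hom_{H⁺}([n], [m])`; only `m = n` contributes. -/
def HPlusFrom (X : IFas) : Type := Σ Y : IFas, {h : X ⟶ Y // isHPlus h}

/-- Every morphism is uniquely a morphism of `H⁺` followed by a morphism of `ΔD`. -/
theorem existsUnique_hPlusPart {X Y : IFas} (f : X ⟶ Y) :
    ∃! s : HPlusFrom X, ∃ d : s.1 ⟶ Y, isDeltaD d ∧ s.2.1 ≫ d = f := by
  obtain ⟨h, d, hh, hd, rfl⟩ := exists_factorization f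
  refine ⟨⟨X, h, hh⟩, ⟨d, hd, rfl⟩, ?_⟩
  rintro ⟨Z, h', hh'⟩ ⟨d', hd', heq⟩
  obtain rfl := hh'.eq_dom
  obtain rfl := factorization_unique hh' hh hd' hd heq
  rfl

/-- The component in `H⁺` of a morphism. -/
def hPlusPart {X Y : IFas} (f : X ⟶ Y) : HPlusFrom X := (existsUnique_hPlusPart f).choose

lemma hPlusPart_spec {X Y : IFas} (f : X ⟶ Y) :
    ∃ d : (hPlusPart f).1 ⟶ Y, isDeltaD d ∧ (hPlusPart f).2.1 ≫ d = f :=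
  (existsUnique_hPlusPart f).choose_spec.1

lemma hPlusPart_eq {X Y : IFas} (f : X ⟶ Y) (s : HPlusFrom X) (d : s.1 ⟶ Y)
    (hd : isDeltaD d) (h : s.2.1 ≫ d = f) : hPlusPart f = s :=
  ((existsUnique_hPlusPart f).choose_spec.2 s ⟨d, hd, h⟩).symm

/-- Precomposition with `f` on the morphisms of `H⁺`: send `h` to the `H⁺`-component of `h ∘ f`. -/
def precompHPlus {X Y : IFas} (f : X ⟶ Y) (s : HPlusFrom Y) : HPlusFrom X :=
  hPlusPart (f ≫ s.2.1)

lemma precompHPlus_id (X : IFas) (s : HPlusFrom X) : precompHPlus (𝟙 X) s = s :=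
  hPlusPart_eq _ s (𝟙 _) (isDeltaD.id_mem _) (by simp)

lemma precompHPlus_comp {X Y Z : IFas} (f : X ⟶ Y) (g : Y ⟶ Z) (s : HPlusFrom Z) :
    precompHPlus (f ≫ g) s = precompHPlus f (precompHPlus g s) := by
  obtain ⟨d, hd, h⟩ := hPlusPart_spec (g ≫ s.2.1)
  obtain ⟨d', hd', h'⟩ := hPlusPart_spec (f ≫ (hPlusPart (g ≫ s.2.1)).2.1)
  refine hPlusPart_eq _ _ (d' ≫ d) (isDeltaD.comp_mem _ _ hd' hd) ?_
  calc _ = ((hPlusPart (f ≫ (hPlusPart (g ≫ s.2.1)).2.1)).2.1 ≫ d') ≫ d := (Category.assoc _ _ _).symm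
    _ = (f ≫ (hPlusPart (g ≫ s.2.1)).2.1) ≫ d := congrArg (· ≫ d) h'
    _ = f ≫ (hPlusPart (g ≫ s.2.1)).2.1 ≫ d := Category.assoc _ _ _
    _ = f ≫ g ≫ s.2.1 := congrArg (f ≫ ·) h
    _ = _ := (Category.assoc _ _ _).symm

/-- The functor `B`: on objects, the free module `k[∐_m Hom_{H⁺}([n], [m])]`, and on morphisms
given by precomposition. -/
def functorB (k : Type u) [CommRing k] : IFasᵒᵖ ⥤ ModuleCat.{u} k where
  obj X := ModuleCat.of k (HPlusFrom X.unop →₀ k)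
  map f := ModuleCat.ofHom (Finsupp.lmapDomain k k (precompHPlus f.unop))
  map_id X := by
    ext s : 2
    ext
    simp [precompHPlus_id]
  map_comp f g := by
    ext s : 2
    ext
    simp [precompHPlus_comp]

end IFas

/-- The objects `[n]`, `n ≥ 0`, of the reflexive category `ΔR`. -/
structure DeltaR where
  len : ℕ

namespace DeltaR

/-- A morphism `[m] ⟶ [n]` of `ΔR` is a pair `(φ, g)` of a morphism `φ` of `Δ` and an element `g` of
the group `{1, r}` of order two in degree `m`; it stands for `φ ∘ g`. The group is `ℤˣ`, with `r = -1`. -/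
@[ext]
structure Hom (X Y : DeltaR) where
  map : SimplexCategory.mk X.len ⟶ SimplexCategory.mk Y.len
  sign : ℤˣ

/-- Conjugation by `r ^ ε`: `r ∘ φ ∘ r` is the monotone map `i ↦ n - φ(m - i)`. -/
def conj (ε : ℤˣ) {m n : ℕ} (φ : SimplexCategory.mk m ⟶ SimplexCategory.mk n) :
    SimplexCategory.mk m ⟶ SimplexCategory.mk n :=
  if ε = 1 then φ else SimplexCategory.rev.map φ

lemma conj_id (ε : ℤˣ) (m : ℕ) : conj ε (𝟙 (SimplexCategory.mk m)) = 𝟙 _ := by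
  unfold conj
  split_ifs
  · rfl
  · exact SimplexCategory.rev.map_id _

lemma conj_comp (ε : ℤˣ) {l m n : ℕ} (φ : SimplexCategory.mk l ⟶ SimplexCategory.mk m)
    (ψ : SimplexCategory.mk m ⟶ SimplexCategory.mk n) :
    conj ε (φ ≫ ψ) = conj ε φ ≫ conj ε ψ := by
  unfold conj
  split_ifs
  · rfl
  · exact SimplexCategory.rev.map_comp _ _

lemma conj_conj (ε δ : ℤˣ) {m n : ℕ} (φ : SimplexCategory.mk m ⟶ SimplexCategory.mk n) :
    conj ε (conj δ φ) = conj (δ * ε) φ := by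
  have := SimplexCategory.rev_map_rev_map φ
  rcases Int.units_eq_one_or ε with rfl | rfl <;> rcases Int.units_eq_one_or δ with rfl | rfl <;>
    simp [conj, IFas.one_ne_t.symm, this]

/-- The reflexive category: `(ψ ∘ r^δ) ∘ (φ ∘ r^ε) = (ψ ∘ (r^δ φ r^δ)) ∘ r^(δ ε)`. -/
instance : SmallCategory DeltaR where
  Hom := Hom
  id X := ⟨𝟙 _, 1⟩
  comp f g := ⟨conj g.sign f.map ≫ g.map, f.sign * g.sign⟩
  id_comp f := by
    apply Hom.ext
    · simp [conj_id]
    · simp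
  comp_id f := by
    apply Hom.ext
    · simp [conj]
    · simp
  assoc f g h := by
    apply Hom.ext
    · simp [conj_comp, conj_conj]
    · simp [mul_assoc]

@[simp] lemma id_map (X : DeltaR) : Hom.map (𝟙 X) = 𝟙 _ := rfl
@[simp] lemma id_sign (X : DeltaR) : Hom.sign (𝟙 X) = 1 := rfl
@[simp] lemma comp_map {X Y Z : DeltaR} (f : X ⟶ Y) (g : Y ⟶ Z) :
    Hom.map (f ≫ g) = conj g.sign f.map ≫ g.map := rfl
@[simp] lemma comp_sign {X Y Z : DeltaR} (f : X ⟶ Y) (g : Y ⟶ Z) :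
    Hom.sign (f ≫ g) = f.sign * g.sign := rfl

end DeltaR

namespace IFas

open scoped Simplicial

/-- The number of `y` with `φ(y) < j`; that is, the least `y` with `φ(y) ≥ j`, or `m + 1` if there
is none. -/
def cut {m n : ℕ} (φ : ⦋m⦌ ⟶ ⦋n⦌) (j : ℕ) : ℕ :=
  (Finset.univ.filter fun y : Fin (m + 1) => ((φ y : Fin (n + 1)) : ℕ) < j).card

section cut
variable {m n : ℕ} (φ : ⦋m⦌ ⟶ ⦋n⦌)

lemma cut_zero : cut φ 0 = 0 := by simp [cut]

lemma cut_of_lt {j : ℕ} (h : n < j) : cut φ j = m + 1 := by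
  have : ∀ y : Fin (m + 1), ((φ y : Fin (n + 1)) : ℕ) < j := fun y => by
    have : ((φ y : Fin (n + 1)) : ℕ) < n + 1 := (φ y : Fin (n + 1)).is_lt
    omega
  simp only [cut]
  rw [Finset.filter_true_of_mem (fun y _ => this y)]
  simp

lemma cut_le (j : ℕ) : cut φ j ≤ m + 1 := by
  simpa [cut] using Finset.card_filter_le (Finset.univ : Finset (Fin (m + 1)))
    (fun y => ((φ y : Fin (n + 1)) : ℕ) < j)

lemma cut_mono {i j : ℕ} (h : i ≤ j) : cut φ i ≤ cut φ j :=
  Finset.card_le_card fun y hy => by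
    simp only [Finset.mem_filter, Finset.mem_univ, true_and] at hy ⊢
    omega

lemma lt_cut_iff (j : ℕ) (y : Fin (m + 1)) : (y : ℕ) < cut φ j ↔ ((φ y : Fin (n + 1)) : ℕ) < j := by
  have hm : ∀ x y : Fin (m + 1), x ≤ y → (φ x : Fin (n + 1)) ≤ φ y := fun x y h =>
    φ.toOrderHom.monotone h
  constructor
  · intro h
    by_contra hc
    have : cut φ j ≤ y := by
      calc cut φ j ≤ (Finset.univ.filter fun x : Fin (m + 1) => x < y).card := by
            refine Finset.card_le_card fun x hx => ?_
            simp only [Finset.mem_filter, Finset.mem_univ, true_and] at hx ⊢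
            by_contra hxy
            have := hm y x (not_lt.1 hxy)
            rw [Fin.le_def] at this
            omega
        _ = y := by rw [Finset.filter_gt_eq_Iio, Fin.card_Iio]
    omega
  · intro h
    calc (y : ℕ) < (Finset.univ.filter fun x : Fin (m + 1) => x ≤ y).card := by
          rw [Finset.filter_ge_eq_Iic, Fin.card_Iic]; omega
      _ ≤ cut φ j := by
          refine Finset.card_le_card fun x hx => ?_
          simp only [Finset.mem_filter, Finset.mem_univ, true_and] at hx ⊢
          have := hm x y hx
          rw [Fin.le_def] at this
          omega

lemma cut_id (j : ℕ) (hj : j ≤ m + 1) : cut (𝟙 ⦋m⦌) j = j := by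
  have h1 := cut_le (𝟙 ⦋m⦌) j
  apply le_antisymm
  · by_contra h
    have := (lt_cut_iff (𝟙 ⦋m⦌) j ⟨j, by omega⟩).1 (by simpa using h)
    simp at this
  · by_contra h
    have := (lt_cut_iff (𝟙 ⦋m⦌) j ⟨cut (𝟙 ⦋m⦌) j, by omega⟩).2 (by simpa using h)
    simp at this

lemma cut_comp {l : ℕ} (θ : ⦋l⦌ ⟶ ⦋m⦌) (j : ℕ) : cut (θ ≫ φ) j = cut θ (cut φ j) := by
  unfold cut
  congr 1
  ext y
  simp only [Finset.mem_filter, Finset.mem_univ, true_and]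
  exact (lt_cut_iff φ j (θ y)).symm

lemma cut_rev (j : ℕ) (hj : j ≤ n + 1) :
    cut (SimplexCategory.rev.map φ) j + cut φ (n + 1 - j) = m + 1 := by
  have h1 : cut (SimplexCategory.rev.map φ) j =
      (Finset.univ.filter fun y : Fin (m + 1) =>
        ¬ ((φ y : Fin (n + 1)) : ℕ) < n + 1 - j).card := by
    unfold cut
    refine Finset.card_equiv Fin.revPerm fun y => ?_
    simp only [Finset.mem_filter, Finset.mem_univ, true_and, Fin.revPerm_apply]
    change ((Fin.rev (φ (Fin.rev y) : Fin (n + 1)) : Fin (n + 1)) : ℕ) < j ↔ _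
    change n + 1 - (((φ (Fin.rev y) : Fin (n + 1)) : ℕ) + 1) < j ↔ _
    have : ((φ (Fin.rev y) : Fin (n + 1)) : ℕ) < n + 1 := (φ (Fin.rev y) : Fin (n + 1)).is_lt
    omega
  rw [h1, add_comm]
  unfold cut
  rw [Finset.card_filter_add_card_filter_not]
  simp

end cut

/-- The standard inclusion of `Δᵒᵖ` on morphisms. A monotone map `φ : [m] ⟶ [n]` gives the map
`[n] ⟶ [m]` sending `j` to the least `y` with `φ(y) ≥ j`, or to `0` if there is none. All labels are
trivial, and the fibres have the natural ordering, except that over `0` the elements `j` with no such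
`y` come first. For example the face `d_n` (from the injection missing `n`) has `{n < 0}` as its fibre
over `0`, as in the cyclic bar construction, where it multiplies `a_n a_0`. -/
def ofSimplex {m n : ℕ} (φ : ⦋m⦌ ⟶ ⦋n⦌) : IFas.mk n ⟶ IFas.mk m where
  toFun j := Fin.ofNat (m + 1) (cut φ j)
  lt a b := (cut φ a = cut φ b ∧ a < b) ∨ (cut φ a = m + 1 ∧ cut φ b = 0)
  label _ := 1
  lt_fiber a b := by
    rintro (⟨h, -⟩ | ⟨h, h'⟩)
    · rw [h]
    · rw [h, h']; ext; simp
  lt_irrefl a := by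
    rintro (⟨-, h⟩ | h)
    · exact lt_irrefl _ h
    · omega
  lt_trans a b c := by
    simp only [Fin.lt_def]
    omega
  lt_total a b h h' := by
    have ha := cut_le φ a
    have hb := cut_le φ b
    have : a < b ∨ b < a := lt_or_gt_of_ne h'
    have h1 : cut φ a % (m + 1) = cut φ b % (m + 1) := congrArg Fin.val h
    rcases ha.lt_or_eq with ha | ha <;> rcases hb.lt_or_eq with hb | hb <;>
      simp only [Nat.mod_eq_of_lt, ha, hb, Nat.mod_self] at h1 <;> omega

/-- The reflection `[n] ⟶ [n]`: `0 ↦ 0`, `i ↦ n + 1 - i` for `i > 0`, and all labels equal to `t`. -/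
def reflect (n : ℕ) : IFas.mk n ⟶ IFas.mk n := ofPerm _ (Equiv.neg _) fun _ => -1

lemma reflect_reflect (n : ℕ) : reflect n ≫ reflect n = 𝟙 _ := by
  unfold reflect
  rw [ofPerm_comp]
  apply hom_ext
  · funext a; simp [ofPerm]
  · rfl
  · funext a; simp [ofPerm]

lemma ofSimplex_id (n : ℕ) : ofSimplex (𝟙 ⦋n⦌) = 𝟙 (IFas.mk n) := by
  have h : ∀ a : ℕ, a < n + 1 → cut (𝟙 ⦋n⦌) a = a := fun a ha => cut_id a (by omega)
  apply hom_ext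
  · funext a
    have ha : (a : ℕ) < n + 1 := a.is_lt
    ext
    change cut (𝟙 ⦋n⦌) a % (n + 1) = a
    rw [h a ha, Nat.mod_eq_of_lt ha]
  · funext a b
    have ha := h a a.is_lt
    have hb := h b b.is_lt
    have key : ∀ p q a b : ℕ, p = a → q = b → a < n + 1 →
        ((p = q ∧ a < b) ∨ (p = n + 1 ∧ q = 0) ↔ False) := by
      intro p q a b h1 h2 h3
      rw [iff_false]
      omega
    exact propext (key _ _ _ _ ha hb a.is_lt)
  · rfl

lemma ofSimplex_comp {l m n : ℕ} (φ : ⦋l⦌ ⟶ ⦋m⦌) (ψ : ⦋m⦌ ⟶ ⦋n⦌) :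
    ofSimplex (φ ≫ ψ) = ofSimplex ψ ≫ ofSimplex φ := by
  have hc : ∀ j, cut φ (cut ψ j % (m + 1)) % (l + 1) = cut φ (cut ψ j) % (l + 1) := by
    intro j
    rcases (cut_le ψ j).lt_or_eq with h | h
    · rw [Nat.mod_eq_of_lt h]
    · rw [h, Nat.mod_self, cut_zero, cut_of_lt φ (by omega)]; simp
  apply hom_ext
  · funext j
    ext
    simp [ofSimplex, cut_comp, hc]
  · funext a b
    have hab := @cut_mono _ _ ψ a b
    have hba := @cut_mono _ _ ψ b a
    have h0 := cut_zero φ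
    have h1 := cut_of_lt φ (j := m + 1) (by omega)
    have hp := cut_le ψ a
    have hq := cut_le ψ b
    have hpq := @cut_mono _ _ φ (cut ψ a) (cut ψ b)
    have hqp := @cut_mono _ _ φ (cut ψ b) (cut ψ a)
    simp only [comp_lt, eq_iff_iff, ofSimplex, cut_comp, Fin.val_ofNat, Fin.lt_def, Fin.ext_iff,
      one_ne_t, false_and, or_false, true_and]
    have hφp := cut_le φ (cut ψ a)
    have hφq := cut_le φ (cut ψ b)
    clear hc
    generalize cut ψ a = p at *
    generalize cut ψ b = q at *
    rcases hp.lt_or_eq with hp | rfl <;> rcases hq.lt_or_eq with hq | rfl <;>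
      simp only [Nat.mod_eq_of_lt, hp, hq, Nat.mod_self, h0, h1] <;> grind
  · funext a
    simp [ofSimplex]

lemma ofSimplex_rev {m n : ℕ} (φ : ⦋m⦌ ⟶ ⦋n⦌) :
    ofSimplex (SimplexCategory.rev.map φ) ≫ reflect m = reflect n ≫ ofSimplex φ := by
  have h0 := cut_zero φ
  have h1 := cut_of_lt φ (j := n + 1) (by omega)
  have hneg : ∀ {n : ℕ} (a : Fin (n + 1)), ((-a : Fin (n + 1)) : ℕ) = if (a : ℕ) = 0 then 0 else n + 1 - a := by
    intro n a
    rw [Fin.val_neg]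
    simp only [Fin.ext_iff, Fin.val_zero]
  apply hom_ext
  · funext a
    have h3 : (a : ℕ) < n + 1 := a.is_lt
    have hr := cut_rev φ a (by omega)
    ext
    simp only [comp_toFun, reflect, ofPerm, ofSimplex, Equiv.neg_apply, hneg, Fin.val_ofNat]
    have h2 := cut_le φ (n + 1 - a)
    have h4 : cut (SimplexCategory.rev.map φ) a = m + 1 - cut φ (n + 1 - a) := by omega
    rw [h4]
    by_cases ha : (a : ℕ) = 0
    · simp [ha, h0, h1]
    · simp only [ha, if_false]
      rcases h2.lt_or_eq with h | h
      · by_cases h5 : cut φ (n + 1 - a) = 0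
        · simp [h5]
        · rw [Nat.mod_eq_of_lt h, Nat.mod_eq_of_lt (by omega)]
          rw [if_neg (by omega)]
          omega
      · simp [h]
  · funext a b
    have ha' : (a : ℕ) < n + 1 := a.is_lt
    have hb' : (b : ℕ) < n + 1 := b.is_lt
    have ha := cut_rev φ a (by omega)
    have hb := cut_rev φ b (by omega)
    have e : ∀ a b, (ofSimplex (SimplexCategory.rev.map φ) ≫ reflect m).lt a b ↔
        (ofSimplex (SimplexCategory.rev.map φ)).lt b a := by
      intro a b
      have hf := (ofSimplex (SimplexCategory.rev.map φ)).lt_fiber b a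
      simp only [comp_lt, reflect, ofPerm, one_ne_t.symm, false_and, false_or, true_and]
      exact ⟨fun h => h.2, fun h => ⟨(hf h).symm, h⟩⟩
    simp only [e, eq_iff_iff]
    simp only [comp_lt, reflect, ofPerm, ofSimplex, Equiv.neg_apply, hneg, Fin.lt_def, and_false,
      or_false]
    clear e
    have key1 : ∀ a b ra rb cb : ℕ, a = 0 → b ≠ 0 → b < n + 1 → ra + (m + 1) = m + 1 →
        rb + cb = m + 1 → ((rb = ra ∧ b < a) ∨ (rb = m + 1 ∧ ra = 0) ↔
          (0 = cb ∧ 0 < n + 1 - b) ∨ (0 = m + 1 ∧ cb = 0)) := by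
      omega
    have key2 : ∀ a b ra rb ca : ℕ, a ≠ 0 → b = 0 → a < n + 1 → ra + ca = m + 1 →
        rb + (m + 1) = m + 1 → ((rb = ra ∧ b < a) ∨ (rb = m + 1 ∧ ra = 0) ↔
          (ca = 0 ∧ n + 1 - a < 0) ∨ (ca = m + 1 ∧ 0 = 0)) := by
      omega
    split_ifs with h5 h6 h6
    · have hab : a = b := Fin.ext (h5.trans h6.symm)
      have h7 : cut φ (n + 1 - a) = m + 1 := by rw [h5]; exact h1
      rw [h0, ← hab]
      omega
    · have h7 : cut φ (n + 1 - a) = m + 1 := by rw [h5]; exact h1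
      rw [h7] at ha
      rw [h0]
      exact key1 _ _ _ _ _ h5 h6 hb' ha hb
    · have h7 : cut φ (n + 1 - b) = m + 1 := by rw [h6]; exact h1
      rw [h7] at hb
      rw [h0]
      exact key2 _ _ _ _ _ h5 h6 ha' ha hb
    · omega
  · funext a
    simp [reflect, ofPerm, ofSimplex]

end IFas

/-! ### The inclusion of the opposite of the reflexive category, and reflexive homology -/

/-- The category of based involutive non-commutative sets: same objects, and the
morphisms `f` with `f(0) = 0`. -/
abbrev IGammaAs : Type := WideSubcategory IFas.isBased

/-- The functor `B'`: the restriction of `B` to based involutive non-commutative sets. -/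
def functorBPrime (k : Type u) [CommRing k] : IGammaAsᵒᵖ ⥤ ModuleCat.{u} k :=
  (wideSubcategoryInclusion IFas.isBased).op ⋙ IFas.functorB k

namespace DeltaR

/-- The powers of the reflection: `r ^ ε` for `ε` in `C₂`. -/
def reflectPow (n : ℕ) (ε : ℤˣ) : IFas.mk n ⟶ IFas.mk n :=
  if ε = 1 then 𝟙 _ else IFas.reflect n

lemma reflectPow_mul (n : ℕ) (ε δ : ℤˣ) :
    reflectPow n (ε * δ) = reflectPow n δ ≫ reflectPow n ε := by
  rcases Int.units_eq_one_or ε with rfl | rfl <;> rcases Int.units_eq_one_or δ with rfl | rfl <;>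
    simp [reflectPow, IFas.one_ne_t.symm, IFas.reflect_reflect]

lemma ofSimplex_conj {m n : ℕ} (ε : ℤˣ) (φ : SimplexCategory.mk m ⟶ SimplexCategory.mk n) :
    IFas.ofSimplex (conj ε φ) ≫ reflectPow m ε = reflectPow n ε ≫ IFas.ofSimplex φ := by
  rcases Int.units_eq_one_or ε with rfl | rfl
  · simp [reflectPow, conj]
  · simp [reflectPow, conj, IFas.one_ne_t.symm, IFas.ofSimplex_rev]

lemma isBased_reflectPow (n : ℕ) (ε : ℤˣ) : IFas.isBased (reflectPow n ε) := by
  unfold reflectPow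
  split_ifs
  · exact IFas.isBased.id_mem _
  · simp [IFas.isBased, IFas.reflect, IFas.ofPerm]

lemma isBased_ofSimplex {m n : ℕ} (φ : SimplexCategory.mk m ⟶ SimplexCategory.mk n) :
    IFas.isBased (IFas.ofSimplex φ) := by
  ext
  simp [IFas.ofSimplex, IFas.cut_zero]

/-- The inclusion `i : ΔRᵒᵖ ⥤ IΓ(as)`: the identity on objects, the standard inclusion
`IFas.ofSimplex` on `Δᵒᵖ`, and the reflection `r` goes to `IFas.reflect`.  A morphism `φ ∘ r ^ ε`
of `ΔR` is sent to `ofSimplex φ` followed by `reflect ^ ε`. -/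
def inclusion : DeltaRᵒᵖ ⥤ IGammaAs where
  obj X := ⟨IFas.mk X.unop.len⟩
  map f := ⟨IFas.ofSimplex f.unop.map ≫ reflectPow _ f.unop.sign,
    IFas.isBased.comp_mem _ _ (isBased_ofSimplex _) (isBased_reflectPow _ _)⟩
  map_id X := by
    apply WideSubcategory.hom_ext
    simp [reflectPow, IFas.ofSimplex_id]
  map_comp {X Y Z} f g := by
    apply WideSubcategory.hom_ext
    change IFas.ofSimplex (conj f.unop.sign g.unop.map ≫ f.unop.map) ≫
        reflectPow _ (g.unop.sign * f.unop.sign) =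
      (IFas.ofSimplex f.unop.map ≫ reflectPow _ f.unop.sign) ≫
        (IFas.ofSimplex g.unop.map ≫ reflectPow _ g.unop.sign)
    rw [IFas.ofSimplex_comp, reflectPow_mul, Category.assoc, Category.assoc,
      ← Category.assoc (IFas.ofSimplex (conj _ _)), ofSimplex_conj, Category.assoc]

end DeltaR

/-- Reflexive homology of `F : ΔRᵒᵖ ⥤ Mod_k`: the graded `k`-module `Tor^{ΔRᵒᵖ}(k^*, F)`. -/
def reflexiveHomology (k : Type u) [CommRing k] (F : DeltaRᵒᵖ ⥤ ModuleCat.{u} k) :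
    GradedObject ℕ (ModuleCat.{u} k) :=
  FunctorHomology.Tor k (FunctorHomology.constantFunctor k) F

end

/-! Every morphism of `IΓ(as)` is uniquely an element of `H⁺` followed by a based morphism of `ΔD`,
and the based morphisms of `ΔD` are exactly the image of the faithful functor `i : ΔRᵒᵖ ⥤ IΓ(as)`.
Hence Hom(X, i(d)) is, naturally in d, a disjoint union of sets Hom(dₛ, d), indexed by the elements
s of `H⁺` with source X: `i` is a multi-right adjoint (`MultiReflection`, established in
`DeltaR.multiReflection`).

Two consequences hold for any such `i : D ⥤ C`. The right Kan extension along `i` sends G to the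
functor X ↦ ∏ₛ G(dₛ). Products of modules preserve surjections, so its left adjoint, restriction
along `i`, preserves projectives. Dually, the left Kan extension of `k^*` is the free module on the
indices s, which gives k^* ⊗_D (F ∘ i) ≅ k[Index] ⊗_C F (`tensorNatIso`). Restriction is also exact,
so it carries a projective resolution of F to one of F ∘ i, and the two Tors agree (`torIso`).
Finally k[Index] is `B'` (`functorBPrime_eq`).

The combinatorial core is the identification of the based part of `ΔD`: the cyclic-order invariant
`Inv` forces a based morphism with trivial labels to be determined by a monotone cut function, that
is, by a morphism of `Δ` (`exists_ofSimplex_eq`). -/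

noncomputable section

/-! ### Derived functors and exact functors preserving projectives. -/

namespace FunctorHomology

/-- Left derived functors can be computed after an exact functor preserving projectives. -/
def leftDerivedCompIso {A B E : Type*} [Category* A] [Abelian A] [HasProjectiveResolutions A]
    [Category* B] [Abelian B] [HasProjectiveResolutions B] [Category* E] [Abelian E]
    (R : A ⥤ B) [R.Additive] [PreservesFiniteLimits R] [PreservesFiniteColimits R]
    [R.PreservesProjectiveObjects]
    (T : B ⥤ E) [T.Additive] (T' : A ⥤ E) [T'.Additive] (e : R ⋙ T ≅ T') (n : ℕ) (X : A) :
    (T.leftDerived n).obj (R.obj X) ≅ (T'.leftDerived n).obj X :=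
  let P := projectiveResolution X
  -- The augmentation is a quasi-isomorphism because `R` is exact and the second factor is an
  -- isomorphism; instance search supplies this field.
  let Q : ProjectiveResolution (R.obj X) :=
    { complex := (R.mapHomologicalComplex _).obj P.complex
      projective := fun n => R.projective_obj (P.complex.X n)
      π := (R.mapHomologicalComplex _).map P.π ≫
        (HomologicalComplex.singleMapHomologicalComplex R _ 0).hom.app X }
  Q.isoLeftDerivedObj T n ≪≫
    (HomologicalComplex.homologyFunctor E _ n).mapIso
      ((NatIso.mapHomologicalComplex e (ComplexShape.down ℕ)).app P.complex) ≪≫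
    (P.isoLeftDerivedObj T' n).symm

end FunctorHomology

/-! ### Multi-right adjoints. -/

/-- Data exhibiting a functor `i : D ⥤ C` as a multi-right adjoint: every morphism `X ⟶ i(d)` factors
uniquely through exactly one member of a family of units `X ⟶ i(dₛ)`. -/
structure MultiReflection {C D : Type} [SmallCategory C] [SmallCategory D] (i : D ⥤ C) where
  Index : C → Type
  refl : ∀ {X : C}, Index X → D
  unit : ∀ {X : C} (s : Index X), X ⟶ i.obj (refl s)
  existsUnique_fac : ∀ {X : C} {d : D} (f : X ⟶ i.obj d),
    ∃! p : Σ s : Index X, refl s ⟶ d, unit p.1 ≫ i.map p.2 = f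

namespace MultiReflection

variable {C D : Type} [SmallCategory C] [SmallCategory D] {i : D ⥤ C} (M : MultiReflection i)

/-- The factorization of a morphism `X ⟶ i(d)` through a unit. -/
def lift {X : C} {d : D} (f : X ⟶ i.obj d) : Σ s : M.Index X, M.refl s ⟶ d :=
  (M.existsUnique_fac f).choose

@[simp]
lemma unit_lift {X : C} {d : D} (f : X ⟶ i.obj d) :
    M.unit (M.lift f).1 ≫ i.map (M.lift f).2 = f :=
  (M.existsUnique_fac f).choose_spec.1

lemma lift_eq {X : C} {d : D} {f : X ⟶ i.obj d} {s : M.Index X} {φ : M.refl s ⟶ d}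
    (h : M.unit s ≫ i.map φ = f) : M.lift f = ⟨s, φ⟩ :=
  ((M.existsUnique_fac f).choose_spec.2 ⟨s, φ⟩ h).symm

lemma lift_comp_map {X : C} {d d' : D} (f : X ⟶ i.obj d) (φ : d ⟶ d') :
    M.lift (f ≫ i.map φ) = ⟨(M.lift f).1, (M.lift f).2 ≫ φ⟩ :=
  M.lift_eq (by rw [Functor.map_comp, ← Category.assoc, unit_lift])

lemma lift_unit {X : C} (s : M.Index X) : M.lift (M.unit s) = ⟨s, 𝟙 _⟩ :=
  M.lift_eq (by simp)

/-- Factor `g` through its unit, then factor `f` followed by that unit; uniqueness makes the result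
the factorization of `f ≫ g`. Functoriality of `pull` and `piObj`, naturality of the counit and the
right triangle identity all rest on this. -/
lemma lift_comp {X Y : C} {d : D} (f : X ⟶ Y) (g : Y ⟶ i.obj d) :
    M.lift (f ≫ g) = ⟨(M.lift (f ≫ M.unit (M.lift g).1)).1,
      (M.lift (f ≫ M.unit (M.lift g).1)).2 ≫ (M.lift g).2⟩ := by
  rw [← M.lift_comp_map, Category.assoc, M.unit_lift]

/-- The action of a morphism of `C` on the indices of the units. -/
def pull {X Y : C} (f : X ⟶ Y) (s : M.Index Y) : M.Index X := (M.lift (f ≫ M.unit s)).1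

lemma pull_id (X : C) (s : M.Index X) : M.pull (𝟙 X) s = s := by
  simp [pull, lift_unit]

lemma pull_comp {X Y Z : C} (f : X ⟶ Y) (g : Y ⟶ Z) (s : M.Index Z) :
    M.pull (f ≫ g) s = M.pull f (M.pull g s) := by
  rw [pull, Category.assoc, lift_comp]
  rfl

lemma pull_lift {X Y : C} {d : D} (f : X ⟶ Y) (g : Y ⟶ i.obj d) :
    M.pull f (M.lift g).1 = (M.lift (f ≫ g)).1 := by
  rw [lift_comp]
  rfl

variable (k : Type u) [CommRing k]

/-- The free modules on the indices of the units, as a right `C`-module. -/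
@[simps]
def freeIndex : Cᵒᵖ ⥤ ModuleCat.{u} k where
  obj X := ModuleCat.of k (M.Index X.unop →₀ k)
  map f := ModuleCat.ofHom (Finsupp.lmapDomain k k (M.pull f.unop))
  map_id X := by
    ext s : 2
    ext
    simp [pull_id]
  map_comp f g := by
    ext s : 2
    ext
    simp [pull_comp]

/-! ### Right Kan extension along a multi-right adjoint. -/

section RightAdjoint

variable {k}

/-- Evaluation of a family of elements, indexed by the units under `X`, at a morphism `X ⟶ i(d)`. -/
def evalLift (G : D ⥤ ModuleCat.{u} k) {X : C} (u : ∀ s : M.Index X, G.obj (M.refl s)) {d : D}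
    (p : Σ s : M.Index X, M.refl s ⟶ d) : G.obj d := G.map p.2 (u p.1)

/-- The right adjoint of restriction along `i`, on objects: the right Kan extension. -/
@[simps]
def piObj (G : D ⥤ ModuleCat.{u} k) : C ⥤ ModuleCat.{u} k where
  obj X := ModuleCat.of k (∀ s : M.Index X, G.obj (M.refl s))
  map f := ModuleCat.ofHom
    { toFun u s := M.evalLift G u (M.lift (f ≫ M.unit s))
      map_add' u v := by funext s; simp [evalLift]
      map_smul' a u := by funext s; simp [evalLift] }
  map_id X := by
    ext u s
    change M.evalLift G u (M.lift (𝟙 X ≫ M.unit s)) = u s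
    rw [Category.id_comp, lift_unit]
    simp [evalLift]
  map_comp f g := by
    ext u s
    simp only [Category.assoc, lift_comp M f (g ≫ _)]
    simp [evalLift]

variable (k) in
/-- The right adjoint of restriction along `i`: the right Kan extension. -/
@[simps]
def piFunctor : (D ⥤ ModuleCat.{u} k) ⥤ (C ⥤ ModuleCat.{u} k) where
  obj := M.piObj
  map α :=
    { app X := ModuleCat.ofHom (LinearMap.pi fun s => (α.app (M.refl s)).hom ∘ₗ LinearMap.proj s)
      naturality X Y f := by
        ext u
        funext s
        exact NatTrans.naturality_apply α _ _ }

variable (k) in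
/-- Restriction along `i` is left adjoint to `piFunctor`. -/
def restrictionAdjunction :
    (Functor.whiskeringLeft D C (ModuleCat.{u} k)).obj i ⊣ M.piFunctor k :=
  Adjunction.mkOfUnitCounit
    { unit :=
        { app F :=
            { app X := ModuleCat.ofHom (LinearMap.pi fun s => (F.map (M.unit s)).hom)
              naturality X Y f := by
                ext x
                funext s
                change F.map (M.unit s) (F.map f x) =
                  F.map (i.map (M.lift (f ≫ M.unit s)).2) (F.map (M.unit _) x)
                simp only [← ConcreteCategory.comp_apply, ← F.map_comp, unit_lift] }
          naturality F F' α := by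
            ext X x
            funext s
            exact (NatTrans.naturality_apply α _ _).symm }
      counit :=
        { app G :=
            { app d := ModuleCat.ofHom
                { toFun u := M.evalLift G u (M.lift (𝟙 (i.obj d)))
                  map_add' u v := by simp [evalLift]
                  map_smul' a u := by simp [evalLift] }
              naturality d d' φ := by
                ext u
                change M.evalLift G (fun s => M.evalLift G u (M.lift (i.map φ ≫ M.unit s)))
                    (M.lift (𝟙 (i.obj d'))) =
                  G.map φ (M.evalLift G u (M.lift (𝟙 (i.obj d))))
                -- Both sides evaluate `u` at the factorization of `i.map φ`, computed once from
                -- `i.map φ ≫ 𝟙` and once from `𝟙 ≫ i.map φ`. As `evalLift` takes the whole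
                -- dependent pair, equal pairs give equal values without transport.
                have h1 := M.lift_comp (i.map φ) (𝟙 (i.obj d'))
                have h2 := M.lift_comp_map (𝟙 (i.obj d)) φ
                have h3 := h1.symm.trans (((congrArg M.lift
                  ((Category.comp_id _).trans (Category.id_comp _).symm))).trans h2)
                have h4 := congrArg (M.evalLift G u) h3
                simpa [evalLift] using h4 }
          naturality G G' α := by
            ext d u
            exact (NatTrans.naturality_apply α _ _).symm }
      left_triangle := by
        ext F d x
        change F.map (i.map (M.lift (𝟙 (i.obj d))).2) (F.map (M.unit _) x) = x
        simp only [← ConcreteCategory.comp_apply, ← F.map_comp, unit_lift]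
        simp
      right_triangle := by
        ext G X u
        funext s
        change M.evalLift G (fun t => M.evalLift G u (M.lift (M.unit s ≫ M.unit t)))
          (M.lift (𝟙 _)) = u s
        have h := congrArg (M.evalLift G u) ((M.lift_comp (M.unit s) (𝟙 _)).symm.trans
          ((congrArg M.lift (Category.comp_id _)).trans (M.lift_unit s)))
        simpa [evalLift] using h }

/-- Epimorphisms of functors are objectwise surjections, and a product of surjections is surjective.
This is what makes the left adjoint preserve projectives. -/
instance : (M.piFunctor k).PreservesEpimorphisms where
  preserves {G G'} α _ := by
    rw [NatTrans.epi_iff_epi_app]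
    intro X
    rw [ModuleCat.epi_iff_surjective]
    intro v
    have h (s : M.Index X) : Function.Surjective (α.app (M.refl s)) :=
      (ModuleCat.epi_iff_surjective _).1 inferInstance
    choose u hu using fun s => h s (v s)
    exact ⟨u, funext hu⟩

include M in
lemma preservesProjectiveObjects_restriction :
    ((Functor.whiskeringLeft D C (ModuleCat.{u} k)).obj i).PreservesProjectiveObjects where
  projective_obj {P} hP := (M.restrictionAdjunction k).map_projective P hP

end RightAdjoint

end MultiReflection

/-! ### Elements of the coend, and maps out of it. -/

namespace FunctorHomology

variable {k : Type u} [CommRing k] {C : Type} [SmallCategory C]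

section
variable (G : Cᵒᵖ ⥤ ModuleCat.{u} k) (F : C ⥤ ModuleCat.{u} k)

/-- The class of `g ⊗ x` in the coend `G ⊗_C F`. -/
def tensorMk (c : C) : G.obj (op c) →ₗ[k] F.obj c →ₗ[k] (tensorFunctor k G).obj F :=
  (TensorProduct.mk k (G.obj (op c)) (F.obj c)).compr₂ (tensorι k G F c).hom

lemma map_tensorMk {F' : C ⥤ ModuleCat.{u} k} (α : F ⟶ F') (c : C)
    (g : G.obj (op c)) (x : F.obj c) :
    (tensorFunctor k G).map α (tensorMk G F c g x) = tensorMk G F' c g (α.app c x) :=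
  ConcreteCategory.congr_hom
    (coend.ι_map ((tensorBifunctor k G).map α) c) (g ⊗ₜ[k] x : (G.obj (op c) ⊗ F.obj c :))

lemma tensorMk_balanced {c d : C} (f : c ⟶ d) (g : G.obj (op d)) (x : F.obj c) :
    tensorMk G F c (G.map f.op g) x = tensorMk G F d g (F.map f x) :=
  ConcreteCategory.congr_hom
    (coend.condition ((tensorBifunctor k G).obj F) f) (g ⊗ₜ[k] x : (G.obj (op d) ⊗ F.obj c :))

end

variable {G : Cᵒᵖ ⥤ ModuleCat.{u} k} {F : C ⥤ ModuleCat.{u} k} {M : ModuleCat.{u} k}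

lemma tensor_hom_ext {φ ψ : (tensorFunctor k G).obj F ⟶ M}
    (h : ∀ c, (tensorMk G F c).compr₂ φ.hom = (tensorMk G F c).compr₂ ψ.hom) : φ = ψ :=
  coend.hom_ext (F := (tensorBifunctor k G).obj F) fun c => by
    apply ModuleCat.hom_ext
    exact TensorProduct.ext (h c)

/-- Maps out of `G ⊗_C F` are balanced families of bilinear maps. -/
def tensorDesc (β : ∀ c, G.obj (op c) →ₗ[k] F.obj c →ₗ[k] M)
    (hβ : ∀ ⦃c d : C⦄ (f : c ⟶ d), β c ∘ₗ (G.map f.op).hom = (β d).compl₂ (F.map f).hom) :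
    (tensorFunctor k G).obj F ⟶ M :=
  coend.desc (F := (tensorBifunctor k G).obj F)
    (fun c => ModuleCat.ofHom (TensorProduct.lift (β c))) (fun c d f => by
      apply ModuleCat.hom_ext
      exact TensorProduct.ext (hβ f))

lemma tensorDesc_tensorMk (β : ∀ c, G.obj (op c) →ₗ[k] F.obj c →ₗ[k] M)
    (hβ : ∀ ⦃c d : C⦄ (f : c ⟶ d), β c ∘ₗ (G.map f.op).hom = (β d).compl₂ (F.map f).hom) (c g x) :
    tensorDesc β hβ (tensorMk G F c g x) = β c g x :=
  ConcreteCategory.congr_hom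
    (coend.ι_desc (F := (tensorBifunctor k G).obj F)
      (fun c => ModuleCat.ofHom (TensorProduct.lift (β c))) _ c)
    (g ⊗ₜ[k] x : (G.obj (op c) ⊗ F.obj c :))

/-- The generator of the constant functor. -/
def constantOne (k : Type u) [CommRing k] (c : C) : (constantFunctor k).obj (op c) := (1 : k)

lemma constant_ext {N : Type*} [AddCommGroup N] [Module k N] {c : C}
    {φ ψ : (constantFunctor k).obj (op c) →ₗ[k] N}
    (h : φ (constantOne k c) = ψ (constantOne k c)) : φ = ψ :=
  LinearMap.ext_ring h

/-- The linear map on the constant functor sending the generator to a given element. -/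
def constantLift {N : Type*} [AddCommGroup N] [Module k N] (c : C) (n : N) :
    (constantFunctor k).obj (op c) →ₗ[k] N :=
  LinearMap.toSpanSingleton k N n

lemma constantLift_one {N : Type*} [AddCommGroup N] [Module k N] (c : C) (n : N) :
    constantLift c n (constantOne k c) = n :=
  one_smul k n

lemma constant_map_one {c d : C} (f : c ⟶ d) :
    (constantFunctor k).map f.op (constantOne k d) = constantOne k c := rfl

end FunctorHomology

/-! ### Comparison of tensor products and of Tor. -/

namespace MultiReflection

open FunctorHomology

variable {C D : Type} [SmallCategory C] [SmallCategory D] {i : D ⥤ C} (M : MultiReflection i)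
variable (k : Type u) [CommRing k]

section

variable {X : C} {N : Type*} [AddCommGroup N] [Module k N]

/-- The basis of the free module on the indices of the units under `X`. -/
def basis (s : M.Index X) : (M.freeIndex k).obj (op X) := Finsupp.single s (1 : k)

lemma freeIndex_map_basis {Y : C} (f : X ⟶ Y) (s : M.Index Y) :
    (M.freeIndex k).map f.op (M.basis k s) = M.basis k (M.pull f s) :=
  Finsupp.mapDomain_single

variable {k}

lemma freeIndex_ext {φ ψ : (M.freeIndex k).obj (op X) →ₗ[k] N}
    (h : ∀ s, φ (M.basis k s) = ψ (M.basis k s)) : φ = ψ :=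
  Finsupp.lhom_ext' fun s => LinearMap.ext_ring (h s)

/-- The linear map on the free module on the indices with given values on the basis. -/
def basisLift (n : M.Index X → N) : (M.freeIndex k).obj (op X) →ₗ[k] N :=
  Finsupp.lift N k (M.Index X) n

lemma basisLift_basis (n : M.Index X → N) (s : M.Index X) :
    M.basisLift n (M.basis k s) = n s :=
  (Finsupp.sum_single_index (zero_smul k (n s))).trans (one_smul k (n s))

end

/-- The canonical map `k^* ⊗_D (F ∘ i) ⟶ k[Index] ⊗_C F`. -/
def tensorHom (F : C ⥤ ModuleCat.{u} k) :
    (tensorFunctor k (constantFunctor k)).obj (i ⋙ F) ⟶ (tensorFunctor k (M.freeIndex k)).obj F :=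
  tensorDesc
    (fun d => constantLift d (tensorMk (M.freeIndex k) F (i.obj d)
      (M.basis k (M.lift (𝟙 (i.obj d))).1)))
    (fun c d f => by
      refine constant_ext (LinearMap.ext fun x => ?_)
      rw [LinearMap.compl₂_apply, LinearMap.comp_apply]
      erw [constant_map_one]
      rw [constantLift_one, constantLift_one]
      refine Eq.trans ?_ (tensorMk_balanced (M.freeIndex k) F (i.map f) _ x)
      -- Pulling the index of the identity of i(d) back along i(f) gives the index of i(f). This is
      -- the index of the identity of i(c), since postcomposition with i(f) does not change the
      -- unit.
      rw [freeIndex_map_basis, pull_lift, Category.comp_id, ← Category.id_comp (i.map f),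
        lift_comp_map])

lemma tensorHom_tensorMk (F : C ⥤ ModuleCat.{u} k) (d : D) (x : F.obj (i.obj d)) :
    M.tensorHom k F (tensorMk (constantFunctor k) (i ⋙ F) d (constantOne k d) x) =
      tensorMk (M.freeIndex k) F (i.obj d) (M.basis k (M.lift (𝟙 (i.obj d))).1) x :=
  (tensorDesc_tensorMk (G := constantFunctor k) (F := i ⋙ F) _ _ d _ x).trans
    (LinearMap.congr_fun (constantLift_one d _) x)

/-- The inverse of `tensorHom`. -/
def tensorInv (F : C ⥤ ModuleCat.{u} k) :
    (tensorFunctor k (M.freeIndex k)).obj F ⟶ (tensorFunctor k (constantFunctor k)).obj (i ⋙ F) :=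
  tensorDesc
    (fun X => M.basisLift fun s =>
      tensorMk (constantFunctor k) (i ⋙ F) (M.refl s) (constantOne k _) ∘ₗ (F.map (M.unit s)).hom)
    (fun X Y f => by
      refine M.freeIndex_ext fun s => LinearMap.ext fun x => ?_
      rw [LinearMap.compl₂_apply, LinearMap.comp_apply]
      erw [freeIndex_map_basis]
      rw [basisLift_basis, basisLift_basis, LinearMap.comp_apply, LinearMap.comp_apply]
      -- Since `f ≫ unit s` factors as the unit of `pull f s` followed by the image of a morphism of
      -- D, sliding that morphism across the tensor leaves F(f ≫ unit s)(x) on both sides.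
      refine (tensorMk_balanced (constantFunctor k) (i ⋙ F) (M.lift (f ≫ M.unit s)).2
        (constantOne k _) (F.map (M.unit (M.pull f s)) x)).trans (congrArg _ ?_)
      change F.map (i.map (M.lift (f ≫ M.unit s)).2) (F.map (M.unit (M.lift (f ≫ M.unit s)).1) x) =
        F.map (M.unit s) (F.map f x)
      simp only [← ConcreteCategory.comp_apply, ← F.map_comp, unit_lift])

lemma tensorInv_tensorMk (F : C ⥤ ModuleCat.{u} k) (X : C) (s : M.Index X) (x : F.obj X) :
    M.tensorInv k F (tensorMk (M.freeIndex k) F X (M.basis k s) x) =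
      tensorMk (constantFunctor k) (i ⋙ F) (M.refl s) (constantOne k _) (F.map (M.unit s) x) :=
  (tensorDesc_tensorMk (G := M.freeIndex k) _ _ X _ x).trans
    (LinearMap.congr_fun (M.basisLift_basis _ s) x)

/-- The isomorphism `k^* ⊗_D (F ∘ i) ≅ k[Index] ⊗_C F`. -/
def tensorIso (F : C ⥤ ModuleCat.{u} k) :
    (tensorFunctor k (constantFunctor k)).obj (i ⋙ F) ≅ (tensorFunctor k (M.freeIndex k)).obj F where
  hom := M.tensorHom k F
  inv := M.tensorInv k F
  hom_inv_id := by
    refine tensor_hom_ext fun d => constant_ext (LinearMap.ext fun x => ?_)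
    refine (congrArg (M.tensorInv k F) (M.tensorHom_tensorMk k F d x)).trans ?_
    refine (M.tensorInv_tensorMk k F _ _ x).trans ?_
    -- Slide the second half of the factorization of the identity across the tensor: the unit
    -- followed by it is the identity again.
    refine (tensorMk_balanced (constantFunctor k) (i ⋙ F)
      (M.lift (𝟙 (i.obj d))).2 (constantOne k _) _).trans ?_
    change _ = tensorMk (constantFunctor k) (i ⋙ F) d (constantOne k d) x
    congr 1
    change F.map (i.map (M.lift (𝟙 (i.obj d))).2) (F.map (M.unit (M.lift (𝟙 (i.obj d))).1) x) = x
    simp only [← ConcreteCategory.comp_apply, ← F.map_comp, unit_lift]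
    simp
  inv_hom_id := by
    refine tensor_hom_ext fun X => M.freeIndex_ext fun s => LinearMap.ext fun x => ?_
    refine (congrArg (M.tensorHom k F) (M.tensorInv_tensorMk k F X s x)).trans ?_
    refine (M.tensorHom_tensorMk k F _ _).trans ?_
    -- Slide `unit s` back to the left factor. The index of the identity of i(dₛ) pulls back along
    -- `unit s` to the index of `unit s`, which is s.
    rw [← tensorMk_balanced, freeIndex_map_basis, pull_lift, Category.comp_id, lift_unit]
    rfl

/-- The isomorphism `k^* ⊗_D (F ∘ i) ≅ k[Index] ⊗_C F`, naturally in `F`. -/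
def tensorNatIso :
    (Functor.whiskeringLeft D C (ModuleCat.{u} k)).obj i ⋙ tensorFunctor k (constantFunctor k) ≅
      tensorFunctor k (M.freeIndex k) :=
  NatIso.ofComponents (M.tensorIso k) fun {F F'} α => by
    refine tensor_hom_ext fun d => constant_ext (LinearMap.ext fun x => ?_)
    refine (congrArg (M.tensorHom k F') (map_tensorMk _ _
      (((Functor.whiskeringLeft D C (ModuleCat.{u} k)).obj i).map α) d _ x)).trans ?_
    refine (M.tensorHom_tensorMk k F' d _).trans ?_
    refine Eq.trans ?_ (congrArg ((tensorFunctor k (M.freeIndex k)).map α)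
      (M.tensorHom_tensorMk k F d x)).symm
    rw [map_tensorMk]
    rfl

/-- A multi-right adjoint `i : D ⥤ C` induces an isomorphism
`Tor^D(k^*, F ∘ i) ≅ Tor^C(k[Index], F)`. -/
def torIso (F : C ⥤ ModuleCat.{u} k) :
    Tor k (constantFunctor k) (i ⋙ F) ≅ Tor k (M.freeIndex k) F :=
  have : ((Functor.whiskeringLeft D C (ModuleCat.{u} k)).obj i).PreservesProjectiveObjects :=
    M.preservesProjectiveObjects_restriction
  GradedObject.isoMk _ _ fun n => leftDerivedCompIso
    ((Functor.whiskeringLeft D C (ModuleCat.{u} k)).obj i) (tensorFunctor k (constantFunctor k))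
    (tensorFunctor k (M.freeIndex k)) (M.tensorNatIso k) n F

end MultiReflection

/-! ### Cut functions, and based morphisms of `ΔD` with trivial labels. -/

namespace IFas
open scoped Simplicial

section cut
variable {m n : ℕ}

/-- The cut counts every y exactly when it counts the last one, because φ is monotone. The j
concerned, those above the maximum of φ, are the ones that wrap around to 0. -/
lemma cut_eq_iff (φ : ⦋m⦌ ⟶ ⦋n⦌) (j : ℕ) :
    cut φ j = m + 1 ↔ ((φ (Fin.last m) : Fin (n + 1)) : ℕ) < j := by
  have h := lt_cut_iff φ j (Fin.last m)
  rw [Fin.val_last] at h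
  have := cut_le φ j
  rw [← h]
  omega

/-- If ψ(y) < φ(y), then at j = φ(y) the element y lies below the cut of ψ but not below that of φ.
Only such values of j are needed, so j ≤ n suffices. -/
lemma eq_of_cut_eq {φ ψ : ⦋m⦌ ⟶ ⦋n⦌} (h : ∀ j : Fin (n + 1), cut φ j = cut ψ j) : φ = ψ := by
  ext y : 3
  apply le_antisymm
  · by_contra! hlt
    exact ((lt_cut_iff φ _ y).1 (h (φ y) ▸ (lt_cut_iff ψ _ y).2 hlt)).false
  · by_contra! hlt
    exact ((lt_cut_iff ψ _ y).1 (h (ψ y) ▸ (lt_cut_iff φ _ y).2 hlt)).false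

/-- The Galois connection between φ and its cuts forces φ(y) = max {j : c(j) ≤ y}. As c is monotone
with c(0) = 0, this set is a nonempty initial segment, so its maximum is its cardinality minus one.
-/
lemma exists_cut_eq (c : Fin (n + 1) → ℕ) (hc : Monotone c) (h0 : c 0 = 0)
    (hle : ∀ j, c j ≤ m + 1) : ∃ φ : ⦋m⦌ ⟶ ⦋n⦌, ∀ j : Fin (n + 1), cut φ j = c j := by
  let S (y : Fin (m + 1)) : Finset (Fin (n + 1)) := Finset.univ.filter fun j => c j ≤ y
  have hpos (y) : 0 < (S y).card := Finset.card_pos.2 ⟨0, by simp [S, h0]⟩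
  have hlt (y) : (S y).card < n + 2 := by
    have := Finset.card_le_univ (S y)
    rw [Fintype.card_fin] at this
    omega
  let φ : ⦋m⦌ ⟶ ⦋n⦌ := SimplexCategory.mkHom
    { toFun y := ⟨(S y).card - 1, by have := hpos y; have := hlt y; omega⟩
      monotone' y y' h := by
        refine Fin.mk_le_mk.2 (Nat.sub_le_sub_right (Finset.card_le_card fun j hj => ?_) 1)
        simp only [S, Finset.mem_filter, Finset.mem_univ, true_and] at hj ⊢
        exact hj.trans h }
  have hφ (y : Fin (m + 1)) : ((φ y : Fin (n + 1)) : ℕ) = (S y).card - 1 := rfl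
  have key (j : Fin (n + 1)) (y : Fin (m + 1)) :
      ((φ y : Fin (n + 1)) : ℕ) < j ↔ (y : ℕ) < c j := by
    have := hpos y
    rw [hφ]
    constructor
    · intro h
      by_contra! hle
      have : (Finset.Iic j).card ≤ (S y).card := Finset.card_le_card fun i hi => by
        simp only [S, Finset.mem_filter, Finset.mem_univ, true_and]
        exact (hc (Finset.mem_Iic.1 hi)).trans hle
      rw [Fin.card_Iic] at this
      omega
    · intro h
      have : (S y).card ≤ (Finset.Iio j).card := Finset.card_le_card fun i hi => by
        simp only [S, Finset.mem_filter, Finset.mem_univ, true_and] at hi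
        rw [Finset.mem_Iio]
        by_contra! hij
        have := hc hij
        omega
      rw [Fin.card_Iio] at this
      omega
  refine ⟨φ, fun j => ?_⟩
  have h1 := cut_le φ j
  have h2 := hle j
  -- Both numbers are at most m + 1, so they agree once the same y ≤ m lie below them.
  have h3 (y : ℕ) (hy : y < m + 1) : y < cut φ j ↔ y < c j :=
    (lt_cut_iff φ j ⟨y, hy⟩).trans (key j ⟨y, hy⟩)
  apply le_antisymm
  · by_contra! h
    exact ((h3 (c j) (by omega)).1 h).false
  · by_contra! h
    exact ((h3 _ (by omega)).2 h).false

end cut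

/-- The underlying map knows the cut only modulo m + 1, which confuses 0 with m + 1. The ordering of
the fibre over 0 separates them: j precedes 0 exactly when its cut is m + 1. -/
lemma ofSimplex_injective {m n : ℕ} {φ ψ : ⦋m⦌ ⟶ ⦋n⦌} (h : ofSimplex φ = ofSimplex ψ) : φ = ψ := by
  have hlt {θ : ⦋m⦌ ⟶ ⦋n⦌} (j : Fin (n + 1)) : (ofSimplex θ).lt j 0 ↔ cut θ j = m + 1 := by
    have : cut θ ((0 : Fin (n + 1)) : ℕ) = 0 := cut_zero θ
    change (cut θ j = cut θ ((0 : Fin (n + 1)) : ℕ) ∧ j < 0) ∨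
      (cut θ j = m + 1 ∧ cut θ ((0 : Fin (n + 1)) : ℕ) = 0) ↔ _
    rw [this]
    simp
  refine eq_of_cut_eq fun j => ?_
  have h1 : cut φ j = m + 1 ↔ cut ψ j = m + 1 := by rw [← hlt, ← hlt, h]
  have h2 : cut φ j % (m + 1) = cut ψ j % (m + 1) :=
    congrArg (fun f : IFas.mk n ⟶ IFas.mk m => ((f.toFun j : Fin (m + 1)) : ℕ)) h
  by_cases h3 : cut φ j = m + 1
  · rw [h3, h1.1 h3]
  · have h4 := cut_le φ j
    have h5 := cut_le ψ j
    have h6 := h1.not.1 h3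
    rwa [Nat.mod_eq_of_lt (by omega), Nat.mod_eq_of_lt (by omega)] at h2

/-- Let l be the maximum of φ. Rotating by n - l moves the wrapped elements j > l in front of all
others, and what remains is a monotone map with natural orderings. -/
lemma isDeltaD_ofSimplex {m n : ℕ} (φ : ⦋m⦌ ⟶ ⦋n⦌) : isDeltaD (ofSimplex φ) := by
  obtain ⟨l, hl⟩ : ∃ l, l = ((φ (Fin.last m) : Fin (n + 1)) : ℕ) := ⟨_, rfl⟩
  have hln : l < n + 1 := hl ▸ (φ (Fin.last m) : Fin (n + 1)).is_lt
  let e : Equiv.Perm (Fin (n + 1)) := Equiv.addRight ⟨n - l, by omega⟩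
  have he (a : Fin (n + 1)) :
      ((a : ℕ) ≤ l ∧ ((e a : Fin (n + 1)) : ℕ) = a + (n - l)) ∨
        (l < a ∧ ((e a : Fin (n + 1)) : ℕ) + l + 1 = a) := by
    have h1 : ((e a : Fin (n + 1)) : ℕ) = (a + (n - l)) % (n + 1) := rfl
    have ha := a.is_lt
    rw [h1]
    rcases le_or_gt (a : ℕ) l with h | h
    · left
      exact ⟨h, Nat.mod_eq_of_lt (by omega)⟩
    · right
      rw [Nat.mod_eq_sub_mod (by omega), Nat.mod_eq_of_lt (by omega)]
      omega
  have hval (a : Fin (n + 1)) :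
      (cut φ a ≤ m ∧ (((ofSimplex φ).toFun a : Fin (m + 1)) : ℕ) = cut φ a ∧ a ≤ l) ∨
      (cut φ a = m + 1 ∧ (((ofSimplex φ).toFun a : Fin (m + 1)) : ℕ) = 0 ∧ l < a) := by
    have h1 : (((ofSimplex φ).toFun a : Fin (m + 1)) : ℕ) = cut φ a % (m + 1) := rfl
    have h2 := cut_eq_iff φ a
    have h3 := cut_le φ a
    rw [← hl] at h2
    rw [h1]
    by_cases h : cut φ a = m + 1
    · exact .inr ⟨h, by rw [h, Nat.mod_self], h2.1 h⟩
    · refine .inl ⟨by omega, Nat.mod_eq_of_lt (by omega), by omega⟩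
  have hfac : ofPerm (IFas.mk n) e (fun _ => 1) ≫
      { toFun := fun b => (ofSimplex φ).toFun (e.symm b)
        lt := fun a b => (ofSimplex φ).toFun (e.symm a) = (ofSimplex φ).toFun (e.symm b) ∧ a < b
        label := fun _ => 1
        lt_fiber := fun _ _ h => h.1
        lt_irrefl := fun _ h => lt_irrefl _ h.2
        lt_trans := fun _ _ _ h h' => ⟨h.1.trans h'.1, h.2.trans h'.2⟩
        lt_total := fun _ _ h h' => (lt_or_gt_of_ne h').imp (⟨h, ·⟩) (⟨h.symm, ·⟩) } =
      ofSimplex φ := by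
    apply hom_ext
    · funext a
      simp [ofPerm]
    · funext a b
      have hlt : (ofSimplex φ).lt a b ↔ (cut φ a = cut φ b ∧ a < b) ∨
        (cut φ a = m + 1 ∧ cut φ b = 0) := Iff.rfl
      simp only [comp_lt, ofPerm, Equiv.symm_apply_apply, eq_iff_iff, hlt, and_false, or_false]
      have ha := hval a
      have hb := hval b
      have ha' := he a
      have hb' := he b
      have h1 : (a : ℕ) < n + 1 := a.is_lt
      have h2 : (b : ℕ) < n + 1 := b.is_lt
      have h3 := cut_mono φ (i := a) (j := b)
      have h4 := cut_mono φ (i := b) (j := a)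
      have key : ∀ a b ea eb ca cb va vb : ℕ, a < n + 1 → b < n + 1 → (a ≤ b → ca ≤ cb) →
          (b ≤ a → cb ≤ ca) →
          (a ≤ l ∧ ea = a + (n - l)) ∨ (l < a ∧ ea + l + 1 = a) →
          (b ≤ l ∧ eb = b + (n - l)) ∨ (l < b ∧ eb + l + 1 = b) →
          (ca ≤ m ∧ va = ca ∧ a ≤ l) ∨ (ca = m + 1 ∧ va = 0 ∧ l < a) →
          (cb ≤ m ∧ vb = cb ∧ b ≤ l) ∨ (cb = m + 1 ∧ vb = 0 ∧ l < b) →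
          (va = vb ∧ ea < eb ↔ (ca = cb ∧ a < b) ∨ (ca = m + 1 ∧ cb = 0)) := by
        intros
        omega
      exact (and_congr_left' Fin.ext_iff).trans (key _ _ _ _ _ _ _ _ h1 h2 h3 h4 ha' hb' ha hb)
    · rfl
  rw [← hfac]
  refine isDeltaD.comp_mem _ _ (isDeltaD_rotate (IFas.mk n) _)
    (.of _ (.ofDelta _ (fun a b hab => ?_) (fun _ _ => Iff.rfl) fun _ => rfl))
  obtain ⟨a, rfl⟩ := e.surjective a
  obtain ⟨b, rfl⟩ := e.surjective b
  change ((ofSimplex φ).toFun (e.symm (e a)) : Fin (m + 1)) ≤ (ofSimplex φ).toFun (e.symm (e b))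
  rw [Equiv.symm_apply_apply, Equiv.symm_apply_apply]
  have ha := hval a
  have hb := hval b
  have ha' := he a
  have hb' := he b
  have h1 : (a : ℕ) < n + 1 := a.is_lt
  have h2 : (b : ℕ) < n + 1 := b.is_lt
  have h3 := cut_mono φ (i := a) (j := b)
  have hab' : ((e a : Fin (n + 1)) : ℕ) ≤ ((e b : Fin (n + 1)) : ℕ) := hab
  rw [Fin.le_def]
  omega

/-- A based morphism with trivial labels that preserves cyclic orders comes from `Δᵒᵖ`. -/
lemma exists_ofSimplex_eq {m n : ℕ} (d : IFas.mk n ⟶ IFas.mk m) (hd : Inv d) (h0 : isBased d)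
    (hl : d.label 0 = 1) : ∃ φ : ⦋m⦌ ⟶ ⦋n⦌, ofSimplex φ = d := by
  classical
  obtain ⟨v, hv⟩ : ∃ v : Fin (n + 1) → ℕ, v = fun a => ((d.toFun a : Fin (m + 1)) : ℕ) := ⟨_, rfl⟩
  obtain ⟨r, hr⟩ : ∃ r : Fin (n + 1) → Fin (n + 1) → Prop, r = d.lt := ⟨_, rfl⟩
  have hv0 : v 0 = 0 := by
    subst hv
    exact congrArg Fin.val h0
  have hvm (a) : v a < m + 1 := by
    subst hv
    exact (d.toFun a).is_lt
  have hfib {a b} (h : r a b) : v a = v b := by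
    subst hv hr
    exact congrArg Fin.val (d.lt_fiber a b h)
  have hirr (a) : ¬ r a a := hr ▸ d.lt_irrefl a
  have htrans {a b c} (h : r a b) (h' : r b c) : r a c := by
    subst hr
    exact d.lt_trans a b c h h'
  have htot {a b} (h : v a = v b) (h' : a ≠ b) : r a b ∨ r b a := by
    subst hv hr
    exact d.lt_total a b (Fin.ext h) h'
  -- This is the cyclic invariant at 0 < a < b. Since d(0) = 0 is the minimum, an element can
  -- precede 0 in the concatenated order only inside the fibre over 0.
  have hcyc {a b : Fin (n + 1)} (ha : 0 < a) (hab : a < b) :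
      ((v 0 < v a ∨ r 0 a) ∧ (v a < v b ∨ r a b)) ∨ ((v a < v b ∨ r a b) ∧ r b 0) ∨
        (r b 0 ∧ (v 0 < v a ∨ r 0 a)) := by
    have h := (hd.2 0 a b (.inl ⟨ha, hab⟩)).1 hl
    have e (x y : Fin (n + 1)) : tlt d x y ↔ v x < v y ∨ r x y := by
      subst hv hr
      exact Iff.rfl
    have e' (x : Fin (n + 1)) : tlt d x 0 ↔ r x 0 := by
      refine (e x 0).trans ⟨fun h => h.resolve_left (by rw [hv0]; exact Nat.not_lt_zero _), .inr⟩
    unfold Cyc at h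
    have e0 := e 0 a
    have e1 := e a b
    have e2 := e' b
    change (tlt d 0 a ∧ tlt d a b) ∨ (tlt d a b ∧ tlt d b 0) ∨ (tlt d b 0 ∧ tlt d 0 a) at h
    tauto
  -- The cut function to be realized: the elements before 0 in its fibre must be the wrapped ones,
  -- hence get the value m + 1.
  let c (a : Fin (n + 1)) : ℕ := if r a 0 then m + 1 else v a
  have hc (a) : (r a 0 ∧ c a = m + 1 ∧ v a = 0) ∨ (¬ r a 0 ∧ c a = v a) := by
    by_cases h : r a 0
    · exact .inl ⟨h, if_pos h, (hfib h).trans hv0⟩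
    · exact .inr ⟨h, if_neg h⟩
  have hmono' {a b : Fin (n + 1)} (hab : a < b) : c a ≤ c b := by
    have h1 := hc a
    have h2 := hc b
    have h3 := hvm a
    rcases (Fin.zero_le a).eq_or_lt with rfl | ha
    · have := hirr 0
      grind
    · have h4 := hcyc ha hab
      have h5 := fun h : r 0 a ∧ r a 0 => hirr 0 (htrans h.1 h.2)
      have h6 := @hfib a b
      have h7 := @hfib a 0
      have h8 := @htrans a b 0
      grind
  have hmono : Monotone c := fun a b hab => hab.lt_or_eq.elim hmono' (fun h => h ▸ le_rfl)
  -- Elements of one fibre are in natural order, except that over 0 the wrapped elements come before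
  -- the unwrapped ones; this is the ordering in `ofSimplex`.
  have hlt {a b : Fin (n + 1)} (hab : a < b) :
      (r a b ↔ c a = c b) ∧ (r b a ↔ c b = m + 1 ∧ c a = 0) := by
    have h1 := hc a
    have h2 := hc b
    have h3 := hvm a
    have h3' := hvm b
    have h6 := @hfib a b
    have h6' := @hfib b a
    have h9 := @htot a b
    have h10 : ¬ (r a b ∧ r b a) := fun h => hirr a (htrans h.1 h.2)
    rcases (Fin.zero_le a).eq_or_lt with rfl | ha
    · have := hirr 0
      have := hab.ne
      grind
    · have h4 := hcyc ha hab
      have h5 : ¬ (r 0 a ∧ r a 0) := fun h => hirr 0 (htrans h.1 h.2)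
      have h5' : ¬ (r 0 b ∧ r b 0) := fun h => hirr 0 (htrans h.1 h.2)
      have h7 := @htot a 0
      have h7' := @htot b 0
      have h8 := @htrans a b 0
      have h8' := @htrans b a 0
      have := hab.ne
      have := ha.ne'
      have := (ha.trans hab).ne'
      grind
  obtain ⟨φ, hφ⟩ := exists_cut_eq c hmono (by have := hirr 0; have := hc 0; grind)
    (m := m) (fun j => by have := hc j; have := hvm j; omega)
  refine ⟨φ, hom_ext ?_ ?_ ?_⟩
  · funext a
    apply Fin.ext
    change cut φ a % (m + 1) = ((d.toFun a : Fin (m + 1)) : ℕ)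
    have : ((d.toFun a : Fin (m + 1)) : ℕ) = v a := by rw [hv]
    rw [this, hφ]
    rcases hc a with ⟨-, h, h'⟩ | ⟨-, h⟩
    · rw [h, h', Nat.mod_self]
    · rw [h, Nat.mod_eq_of_lt (hvm a)]
  · funext a b
    rw [eq_iff_iff, ← hr]
    change (cut φ a = cut φ b ∧ a < b) ∨ (cut φ a = m + 1 ∧ cut φ b = 0) ↔ r a b
    rw [hφ, hφ]
    rcases lt_trichotomy a b with h | h | h
    · have := hmono' h
      rw [(hlt h).1]
      omega
    · subst h
      have := hirr a
      simp only [this, iff_false, lt_irrefl, and_false, false_or]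
      omega
    · rw [(hlt h).2]
      have : ¬ a < b := h.asymm
      tauto
  · funext a
    exact ((hd.1 a).trans hl).symm

end IFas

/-! ### Cancellation of morphisms of `H⁺`. -/

namespace IFas

lemma isHPlus.exists_inv {X Y : IFas} {h : X ⟶ Y} (hh : isHPlus h) :
    ∃ h' : Y ⟶ X, h' ≫ h = 𝟙 Y := by
  obtain rfl := hh.eq_dom
  let σ := Equiv.ofBijective _ hh.1
  -- The labels are carried over without inversion, because every element of `C₂` is its own
  -- inverse.
  refine ⟨ofPerm Y σ.symm fun a => h.label (σ.symm a), ?_⟩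
  apply hom_ext
  · funext a
    exact σ.apply_symm_apply a
  · funext a b
    simp [ofPerm, hh.lt_iff_false]
  · funext a
    exact Int.units_mul_self _

lemma isHPlus.cancel {X Y Z : IFas} {h : X ⟶ Y} (hh : isHPlus h) {d d' : Y ⟶ Z}
    (e : h ≫ d = h ≫ d') : d = d' := by
  obtain ⟨h', hh'⟩ := hh.exists_inv
  rw [← Category.id_comp d, ← hh', Category.assoc, e, ← Category.assoc, hh', Category.id_comp]

/-- Since h fixes 0, the `ΔD`-component of a based morphism is based; so the factorization restricts
to `IΓ(as)`. -/
lemma isHPlus.isBased_of_comp {X Y Z : IFas} {h : X ⟶ Y} (hh : isHPlus h) {d : Y ⟶ Z}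
    (e : isBased (h ≫ d)) : isBased d := by
  have h1 : d.toFun (h.toFun 0) = 0 := e
  rwa [hh.2.1] at h1

end IFas

/-! ### `ΔRᵒᵖ` as the based part of `ΔD`, and the factorization of `IΓ(as)`. -/

namespace DeltaR

lemma reflectPow_reflectPow (n : ℕ) (ε : ℤˣ) : reflectPow n ε ≫ reflectPow n ε = 𝟙 _ := by
  rw [← reflectPow_mul, Int.units_mul_self]
  rfl

lemma isDeltaD_reflectPow (n : ℕ) (ε : ℤˣ) : IFas.isDeltaD (reflectPow n ε) := by
  unfold reflectPow
  split_ifs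
  · exact IFas.isDeltaD.id_mem _
  · have := IFas.isDeltaD_reflect (IFas.mk n) 0
    have e : (Equiv.neg _ : Equiv.Perm (Fin (n + 1))) = Equiv.subLeft 0 := by
      ext1 a
      simp
    unfold IFas.reflect
    rwa [e]

lemma reflectPow_label (n : ℕ) (ε : ℤˣ) (a) : (reflectPow n ε).label a = ε := by
  rcases Int.units_eq_one_or ε with rfl | rfl
  · rfl
  · rfl

lemma isDeltaD_inclusion_map {X Y : DeltaRᵒᵖ} (f : X ⟶ Y) :
    IFas.isDeltaD (inclusion.map f).hom :=
  IFas.isDeltaD.comp_mem _ _ (IFas.isDeltaD_ofSimplex _) (isDeltaD_reflectPow _ _)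

/-- The sign is the label of 0, as `ofSimplex` has trivial labels. Cancelling the reflection then
reduces to `IFas.ofSimplex_injective`. -/
instance : inclusion.Faithful where
  map_injective {X Y} f g h := by
    have h1 : IFas.ofSimplex f.unop.map ≫ reflectPow _ f.unop.sign =
      IFas.ofSimplex g.unop.map ≫ reflectPow _ g.unop.sign := congrArg (·.hom) h
    have hs : f.unop.sign = g.unop.sign := by
      have h2 := congrArg (fun d => IFas.Hom.label d 0) h1
      simp only [IFas.comp_label, reflectPow_label] at h2
      exact (mul_one _).symm.trans (h2.trans (mul_one _))
    have hm : f.unop.map = g.unop.map := by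
      apply IFas.ofSimplex_injective
      have h2 := congrArg (· ≫ reflectPow _ f.unop.sign) h1
      simp only [← hs, Category.assoc, reflectPow_reflectPow, Category.comp_id] at h2
      exact h2
    exact Quiver.Hom.unop_inj (Hom.ext hm hs)

/-- The labels of a morphism of `ΔD` are constant, so composing with the matching power of the
reflection makes them trivial and `IFas.exists_ofSimplex_eq` applies; the reflection is an
involution and can be undone. -/
lemma exists_ofSimplex_comp_reflectPow_eq {m n : ℕ} (d : IFas.mk n ⟶ IFas.mk m)
    (hd : IFas.isDeltaD d) (h0 : IFas.isBased d) :
    ∃ (φ : SimplexCategory.mk m ⟶ SimplexCategory.mk n) (ε : ℤˣ),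
      IFas.ofSimplex φ ≫ reflectPow m ε = d := by
  obtain ⟨φ, hφ⟩ := IFas.exists_ofSimplex_eq (d ≫ reflectPow m (d.label 0))
    (IFas.inv_of_isDeltaD (IFas.isDeltaD.comp_mem _ _ hd (isDeltaD_reflectPow _ _)))
    (IFas.isBased.comp_mem _ _ h0 (isBased_reflectPow _ _))
    (by rw [IFas.comp_label, reflectPow_label, Int.units_mul_self])
  refine ⟨φ, d.label 0, ?_⟩
  rw [hφ, Category.assoc, reflectPow_reflectPow, Category.comp_id]

/-- The based morphisms of `ΔD` are exactly those in the image of `ΔRᵒᵖ`. -/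
lemma exists_inclusion_map_eq {X Y : DeltaRᵒᵖ} (d : inclusion.obj X ⟶ inclusion.obj Y)
    (hd : IFas.isDeltaD d.hom) : ∃ f : X ⟶ Y, inclusion.map f = d := by
  obtain ⟨φ, ε, h⟩ := exists_ofSimplex_comp_reflectPow_eq (m := Y.unop.len) (n := X.unop.len)
    d.hom hd d.property
  exact ⟨Quiver.Hom.op (⟨φ, ε⟩ : Hom Y.unop X.unop), WideSubcategory.hom_ext _ h⟩

/-- The factorization of based involutive non-commutative sets into `H⁺` and `ΔRᵒᵖ`. -/
def multiReflection : MultiReflection inclusion where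
  Index X := IFas.HPlusFrom X.obj
  refl s := op ⟨s.1.len⟩
  unit s := ⟨s.2.1, s.2.2.2.1⟩
  existsUnique_fac {X d} f := by
    obtain ⟨δ, hδ, hf⟩ := IFas.hPlusPart_spec f.hom
    obtain ⟨φ, hφ⟩ := exists_inclusion_map_eq (X := op ⟨(IFas.hPlusPart f.hom).1.len⟩) (Y := d)
      ⟨δ, (IFas.hPlusPart f.hom).2.2.isBased_of_comp
        ((congrArg (fun e => IFas.isBased e) hf).mpr f.property)⟩ hδ
    refine ⟨⟨IFas.hPlusPart f.hom, φ⟩, ?_, ?_⟩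
    · apply WideSubcategory.hom_ext
      exact (congrArg (fun e => (IFas.hPlusPart f.hom).2.1 ≫ e.hom) hφ).trans hf
    · rintro ⟨s, ψ⟩ h
      have h1 : s.2.1 ≫ (inclusion.map ψ).hom = f.hom := congrArg (·.hom) h
      -- Uniqueness of the `H⁺`-component fixes the index. The remaining morphism is then fixed by
      -- left cancellation of that component and faithfulness of the inclusion.
      obtain rfl : IFas.hPlusPart f.hom = s :=
        IFas.hPlusPart_eq f.hom s _ (isDeltaD_inclusion_map ψ) h1
      congr 1
      apply inclusion.map_injective
      rw [hφ]
      apply WideSubcategory.hom_ext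
      exact IFas.isHPlus.cancel (IFas.hPlusPart f.hom).2.2 (h1.trans hf.symm)

/-- The factorization through a unit is a factorization into `H⁺` and `ΔD`, so its index is the
`H⁺`-component by uniqueness. -/
lemma multiReflection_pull {X Y : IGammaAs} (f : X ⟶ Y) (s : IFas.HPlusFrom Y.obj) :
    multiReflection.pull f s = IFas.precompHPlus f.hom s := by
  symm
  refine IFas.hPlusPart_eq _ _ _ (isDeltaD_inclusion_map (multiReflection.lift
    (f ≫ multiReflection.unit s)).2) ?_
  exact congrArg (·.hom) (multiReflection.unit_lift (f ≫ multiReflection.unit s))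

/-- The two functors have definitionally equal values, so only the actions of morphisms on the bases
have to be compared, which is `multiReflection_pull`. -/
lemma functorBPrime_eq (k : Type u) [CommRing k] :
    functorBPrime k = multiReflection.freeIndex k := by
  refine CategoryTheory.Functor.hext (fun _ => rfl) fun X Y f => heq_of_eq ?_
  have h : IFas.precompHPlus f.unop.hom = multiReflection.pull f.unop :=
    funext fun s => (multiReflection_pull f.unop s).symm
  exact congrArg (fun p => ModuleCat.ofHom (Finsupp.lmapDomain k k p)) h

end DeltaR

end

theorem theorem10p1 {k : Type u} [CommRing k] (F : IGammaAs ⥤ ModuleCat.{u} k) :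
    Nonempty (reflexiveHomology k (DeltaR.inclusion ⋙ F) ≅
      FunctorHomology.Tor k (functorBPrime k) F) := by
  rw [DeltaR.functorBPrime_eq]
  exact ⟨DeltaR.multiReflection.torIso k F⟩
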